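/- Let $\mathcal X,\mathcal Y,\mathcal Z$ be finite sets, $P_{Y,Z|X}$ a channel from $\mathcal X$ to $\mathcal Y\times\mathcal Z$, $\mathsf C:\mathcal X\to\mathbb R_{\ge 0}$ a cost function, and $b\ge \min_{x\in\mathcal X}\mathsf C(x)$. Logarithms are to base $2$. An $(n,R)$-code, with message set $\mathcal M_n=\{1,\dots,\lfloor 2^{nR}\rfloor\}$, consists of a stochastic encoder assigning to each $m\in\mathcal M_n$ a probability mass function $f_n(\cdot|m)$ on $\mathcal X^n$ such that $\sum_{\mathbf x} f_n(\mathbf x|m)\,\frac1n\sum_{i=1}^n\mathsf C(x_i)\le b$ for every $m$, and of a decoder $g_n:\mathcal Y^n\to\mathcal M_n$. The input is sent over the memoryless channel $P_{Y,Z|X}^{\otimes n}$; $e(c_n)$ denotes the maximal (over $m\in\mathcal M_n$) probability that $g_n(\mathbf Y)\ne m$ when $m$ is sent, and $\ell(P_M,c_n)=I(M;\mathbf Z)$ when the message has law $P_M$. The security metrics are $\ell_{\mathsf{weak}}=\frac1n\ell(\bar P_M,c_n)$ and $\ell_{\mathsf{str}}=\ell(\bar P_M,c_n)$, with $\bar P_M$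 uniform on $\mathcal M_n$, and $\ell_{\mathsf{sem}}=\max_{P_M}\ell(P_M,c_n)$. For $\bullet\in\{\mathsf{sem},\mathsf{str},\mathsf{weak}\}$, a rate $R\ge0$ is achievable if for every $\epsilon>0$ and all sufficiently large $n$ there is an $(n,R)$-code $c_n$ with $\max\{e(c_n),\ell_\bullet(c_n)\}\le\epsilon$; the capacity $C_\bullet(b)$ is the supremum of the achievable rates, and this supremum is finite. Then $$C_{\mathsf{sem}}(b)=C_{\mathsf{str}}(b)=C_{\mathsf{weak}}(b)=\bar C(b):=\max\big\{I(V;Y|U)-I(V;Z|U)\big\},$$ where the maximum is over all finite sets $\mathcal U,\mathcal V$ and all probability mass functions on $\mathcal U\times\mathcal V\times\mathcal X$ of the form $P_{U,V}P_{X|V}$ with $\mathbb E[\mathsf C(X)]\le b$, the mutual informations are taken with respect to $P_{U,V}P_{X|V}P_{Y,Z|X}$, and the maximum is attained. -/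

import Mathlib

open Filter

noncomputable section

namespace Wiretap

/-! Probability mass functions on a finite set `α` are the elements of `stdSimplex ℝ α`.
All logarithms are to base two, since the message set at rate `R` has `2 ^ (n * R)` elements. -/

section Information

variable {Ω α β γ : Type*} [Fintype Ω] [Fintype α] [Fintype β] [Fintype γ]

open Classical in
/-- `P(A = a)`: the law of the random variable `A` on the finite space `Ω` with mass function
`p`. -/
def law (p : Ω → ℝ) (A : Ω → α) (a : α) : ℝ :=
  ∑ ω, if A ω = a then p ω else 0

/-- The mutual information `I(A; B)` in bits: the Kullback-Leibler divergence of the joint law from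
the product of the marginal laws. Terms with `P(A = a, B = b) = 0` vanish. -/
def mutualInfo (p : Ω → ℝ) (A : Ω → α) (B : Ω → β) : ℝ :=
  ∑ a, ∑ b, law p (fun ω => (A ω, B ω)) (a, b) *
    Real.logb 2 (law p (fun ω => (A ω, B ω)) (a, b) / (law p A a * law p B b))

/-- The conditional mutual information `I(A; B | K)` in bits, that is
`∑ P(a, b, k) log (P(a, b, k) P(k) / (P(a, k) P(b, k)))`. -/
def condMutualInfo (p : Ω → ℝ) (A : Ω → α) (B : Ω → β) (K : Ω → γ) : ℝ :=
  ∑ a, ∑ b, ∑ k, law p (fun ω => (A ω, B ω, K ω)) (a, b, k) *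
    Real.logb 2 (law p (fun ω => (A ω, B ω, K ω)) (a, b, k) * law p K k /
      (law p (fun ω => (A ω, K ω)) (a, k) * law p (fun ω => (B ω, K ω)) (b, k)))

end Information

section Codes

/-- The message set `{1, …, ⌊2 ^ (n R)⌋}`. -/
abbrev Msg (n : ℕ) (R : ℝ) : Type := Fin ⌊(2 : ℝ) ^ ((n : ℝ) * R)⌋₊

variable {X Y Z : Type*} [Fintype X] [Fintype Y] [Fintype Z]

/-- The cost of a sequence: the average of the costs of its letters. -/
def blockCost (C : X → ℝ) {n : ℕ} (x : Fin n → X) : ℝ :=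
  (1 / (n : ℝ)) * ∑ i, C (x i)

/-- An `(n, R)`-code: a stochastic encoder that meets the cost constraint for each message, and a
decoding function. -/
structure Code (X Y : Type*) [Fintype X] (C : X → ℝ) (b : ℝ) (n : ℕ) (R : ℝ) where
  /-- the law `f(· | m)` of the channel input for the message `m` -/
  enc : Msg n R → stdSimplex ℝ (Fin n → X)
  /-- the per-message expected cost constraint -/
  cost_le : ∀ m, ∑ x, enc m x * blockCost C x ≤ b
  /-- the decoding function -/
  dec : (Fin n → Y) → Msg n R

variable (W : X → stdSimplex ℝ (Y × Z)) {C : X → ℝ} {b : ℝ} {n : ℕ} {R : ℝ}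

/-- The memoryless extension `∏ W(yᵢ, zᵢ | xᵢ)` of the channel. -/
def channelPow (x : Fin n → X) (y : Fin n → Y) (z : Fin n → Z) : ℝ :=
  ∏ i, W (x i) (y i, z i)

/-- The memoryless extension of the marginal channel from `X` to `Y`. -/
def mainPow (x : Fin n → X) (y : Fin n → Y) : ℝ :=
  ∏ i, ∑ z, W (x i) (y i, z)

/-- The mass function of `(M, Xⁿ, Yⁿ, Zⁿ, M̂)` that is induced by a code and a message law. -/
def induced (c : Code X Y C b n R) (pM : Msg n R → ℝ) :
    Msg n R × (Fin n → X) × (Fin n → Y) × (Fin n → Z) × Msg n R → ℝ :=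
  fun ω => pM ω.1 * c.enc ω.1 ω.2.1 * channelPow W ω.2.1 ω.2.2.1 ω.2.2.2.1 *
    if ω.2.2.2.2 = c.dec ω.2.2.1 then 1 else 0

/-- The probability of decoding error for the message `m`. -/
def errorProb (c : Code X Y C b n R) (m : Msg n R) : ℝ :=
  ∑ x, c.enc m x * ∑ y, if c.dec y ≠ m then mainPow W x y else 0

/-- The maximal probability of decoding error. -/
def maxErrorProb (c : Code X Y C b n R) : ℝ :=
  ⨆ m, errorProb W c m

/-- The information leakage `I(M; Zⁿ)` when the message has law `pM`. -/
def leakage (c : Code X Y C b n R) (pM : Msg n R → ℝ) : ℝ :=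
  mutualInfo (induced W c pM) (fun ω => ω.1) (fun ω => ω.2.2.2.1)

/-- The uniform law on the message set. -/
def uniformMsg (n : ℕ) (R : ℝ) : Msg n R → ℝ :=
  fun _ => 1 / (Fintype.card (Msg n R) : ℝ)

/-- The weak-secrecy metric. -/
def weakMetric (c : Code X Y C b n R) : ℝ :=
  (1 / (n : ℝ)) * leakage W c (uniformMsg n R)

/-- The strong-secrecy metric. -/
def strongMetric (c : Code X Y C b n R) : ℝ :=
  leakage W c (uniformMsg n R)

/-- The semantic-security metric: the largest leakage over all message laws. -/
def semMetric (c : Code X Y C b n R) : ℝ :=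
  ⨆ pM : stdSimplex ℝ (Msg n R), leakage W c pM

variable (C b)

/-- The set of achievable rates `R ≥ 0` with respect to a security metric on codes. -/
def achievable (metric : ∀ {n : ℕ} {R : ℝ}, Code X Y C b n R → ℝ) : Set ℝ :=
  {R | 0 ≤ R ∧ ∀ ε > 0, ∀ᶠ n : ℕ in atTop, ∃ c : Code X Y C b n R,
    max (maxErrorProb W c) (metric c) ≤ ε}

/-- The rates achievable with semantic-security. -/
def semRates : Set ℝ := achievable W C b (semMetric W)

/-- The rates achievable with strong-secrecy. -/
def strongRates : Set ℝ := achievable W C b (strongMetric W)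

/-- The rates achievable with weak-secrecy. -/
def weakRates : Set ℝ := achievable W C b (weakMetric W)

/-- The semantic-security capacity. -/
def semCapacity : ℝ := sSup (semRates W C b)

/-- The strong-secrecy capacity. -/
def strongCapacity : ℝ := sSup (strongRates W C b)

/-- The weak-secrecy capacity. -/
def weakCapacity : ℝ := sSup (weakRates W C b)

end Codes

section SingleLetter

variable {U V X Y Z : Type*} [Fintype U] [Fintype V] [Fintype X] [Fintype Y] [Fintype Z]

/-- The mass functions of `(U, V, X)` of the form `P(u, v) P(x | v)` whose expected input cost is
at most `b`. -/
def feasible (U V : Type*) [Fintype U] [Fintype V] (C : X → ℝ) (b : ℝ) :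
    Set (stdSimplex ℝ (U × V × X)) :=
  {P | (∃ K : V → stdSimplex ℝ X, ∀ u v x, P (u, v, x) = (∑ x', P (u, v, x')) * K v x) ∧
    ∑ u, ∑ v, ∑ x, P (u, v, x) * C x ≤ b}

/-- The mass function of `(U, V, X, Y, Z)` obtained by sending `X` through the channel. -/
def throughChannel (W : X → stdSimplex ℝ (Y × Z)) (P : stdSimplex ℝ (U × V × X)) :
    U × V × X × Y × Z → ℝ :=
  fun ω => P (ω.1, ω.2.1, ω.2.2.1) * W ω.2.2.1 (ω.2.2.2.1, ω.2.2.2.2)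

/-- `I(V; Y | U) - I(V; Z | U)`. -/
def secrecyGain (W : X → stdSimplex ℝ (Y × Z)) (P : stdSimplex ℝ (U × V × X)) : ℝ :=
  condMutualInfo (throughChannel W P) (fun ω => ω.2.1) (fun ω => ω.2.2.2.1) (fun ω => ω.1) -
    condMutualInfo (throughChannel W P) (fun ω => ω.2.1) (fun ω => ω.2.2.2.2) (fun ω => ω.1)

/-- All values of `I(V; Y | U) - I(V; Z | U)` over feasible laws with finite auxiliary alphabets;
up to bijection such alphabets are `Fin k` and `Fin l`. -/
def secrecyGains (W : X → stdSimplex ℝ (Y × Z)) (C : X → ℝ) (b : ℝ) : Set ℝ :=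
  {r | ∃ k l : ℕ, ∃ P ∈ feasible (Fin k) (Fin l) C b, r = secrecyGain W P}

/-- The single-letter expression for the secrecy-capacity. -/
def singleLetter (W : X → stdSimplex ℝ (Y × Z)) (C : X → ℝ) (b : ℝ) : ℝ :=
  sSup (secrecyGains W C b)

end SingleLetter

end Wiretap

end

open Filter

noncomputable section

set_option linter.unusedSectionVars false

namespace Wiretap

/-! ### Finite sums and divergences -/

section Basics

-- Both halves of the proof rest on the functional `entGap`, Φ(a) = H(Y) - H(Z), of an input measure
-- a that need not be normalized. The two outputs have the same mass, so Φ is homogeneous of degree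
-- one, and I(V;Y|U) - I(V;Z|U) is the sum over u of Φ(∑ v, a u v) - ∑ v, Φ(a u v), with a u v =
-- P(u, v, ·) (`secrecyGain_eq`). A choice of V given u is thus a point (p, t) over p in the convex
-- hull of the graph of Φ, of gain Φ(p) - t, and U averages pairs of gain and cost. The resulting
-- set `region` is compact by Carathéodory's theorem, which gives the maximum over all finite
-- alphabets.
--
-- Converse. Inserting the entropy of the first letter of Y jointly with the later letters of Z
-- splits the block gap H(Yⁿ) - H(Zⁿ) into a shorter block gap and a one-letter gap
-- (`blockGap_succ`), an inductive form of Csiszár's sum identity. Hence I(M;Yⁿ) - I(M;Zⁿ), the mass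
-- n and the total cost form a point of the cone over `region` (`block_split_mem_regionCone`). With
-- Fano's inequality this bounds even the weakly secure rates (`weakRates_le`).
--
-- Achievability. A time-sharing sequence u is fixed, and each message gets L codewords drawn
-- independently from the law of V given u, with (ln L)/n slightly above I(V;Z|U) in nats. A
-- threshold decoder is reliable as long as the total rate stays below I(V;Y|U). Soft covering makes
-- the law of Zⁿ for each message close, in divergence, to one reference law. Error, divergence and
-- the fraction of costly codewords are averaged together, and Markov's inequality discards the
-- worse half of the messages, so that the bounds hold for each message (`exists_oneShot_code`). As
-- I(M;Zⁿ) is at most the average divergence from any fixed law (`kernelInfo_le`), the leakage is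
-- small for all priors at once, which is semantic security. Chernoff bounds make all errors
-- exponentially small.
--
-- Semantic security implies strong secrecy, which implies weak secrecy, so the two halves squeeze
-- the three capacities (`isLUB_of_subset`).

theorem sum_pi_prod {n : ℕ} {α : Type*} [Fintype α] (f : Fin n → α → ℝ) :
    ∑ x : Fin n → α, ∏ i, f i (x i) = ∏ i, ∑ a, f i a := by
  classical
  rw [Finset.prod_univ_sum, Fintype.piFinset_univ]

theorem sum_fin_succ_pi {n : ℕ} {α : Type*} [Fintype α] (f : (Fin (n + 1) → α) → ℝ) :
    ∑ x, f x = ∑ a, ∑ x : Fin n → α, f (Fin.cons a x) := by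
  rw [← Fintype.sum_prod_type (f := fun q : α × (Fin n → α) => f (Fin.cons q.1 q.2))]
  exact ((Fin.consEquiv fun _ => α).sum_comp f).symm

/-- Gibbs' inequality for nonnegative weights. -/
theorem gibbs {α : Type*} [Fintype α] {p q : α → ℝ} (hp : ∀ a, 0 ≤ p a) (hq : ∀ a, 0 ≤ q a)
    (hpq : ∀ a, 0 < p a → 0 < q a) (hs : ∑ a, q a ≤ ∑ a, p a) :
    0 ≤ ∑ a, p a * Real.log (p a / q a) := by
  have h : ∀ a, p a - q a ≤ p a * Real.log (p a / q a) := by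
    intro a
    rcases (hp a).eq_or_lt with h0 | h0
    · rw [← h0]
      simpa using hq a
    · have h1 := Real.log_le_sub_one_of_pos (div_pos (hpq a h0) h0)
      have h2 : Real.log (p a / q a) = - Real.log (q a / p a) := by
        rw [← Real.log_inv, inv_div]
      have h3 := mul_le_mul_of_nonneg_left h1 h0.le
      have h4 : p a * (q a / p a - 1) = q a - p a := by
        field_simp
      rw [h2]
      linarith
  have h1 := Finset.sum_le_sum fun a (_ : a ∈ Finset.univ) => h a
  rw [Finset.sum_sub_distrib] at h1
  linarith

/-- Relative to a nonnegative weight `q`, `log (p / q) ≥ log r` on average for each `r` such that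
`q * r` has no more mass than `p`. -/
theorem sum_mul_log_le_divergence {α : Type*} [Fintype α] {p q r : α → ℝ} (hp : ∀ a, 0 ≤ p a)
    (hq : ∀ a, 0 ≤ q a) (hr : ∀ a, 0 < r a) (hpq : ∀ a, 0 < p a → 0 < q a)
    (hs : ∑ a, q a * r a ≤ ∑ a, p a) :
    ∑ a, p a * Real.log (r a) ≤ ∑ a, p a * Real.log (p a / q a) := by
  have h := gibbs hp (fun a => mul_nonneg (hq a) (hr a).le)
    (fun a ha => mul_pos (hpq a ha) (hr a)) hs
  rw [← sub_nonneg, ← Finset.sum_sub_distrib]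
  refine h.trans_eq (Finset.sum_congr rfl fun a _ => ?_)
  rcases (hp a).eq_or_lt with h0 | h0
  · simp [← h0]
  · have h1 := hpq a h0
    rw [← div_div, Real.log_div (div_pos h0 h1).ne' (hr a).ne']
    ring

end Basics

/-! ### Laws and mutual information -/

section Information

variable {Ω α β γ : Type*} [Fintype Ω]

theorem law_eq [DecidableEq α] (p : Ω → ℝ) (A : Ω → α) (a : α) :
    law p A a = ∑ ω, if A ω = a then p ω else 0 := by
  unfold law
  congr! 2

theorem law_nonneg {p : Ω → ℝ} (hp : ∀ ω, 0 ≤ p ω) (A : Ω → α) (a : α) : 0 ≤ law p A a := by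
  unfold law
  refine Finset.sum_nonneg fun ω _ => ?_
  split_ifs
  exacts [hp ω, le_rfl]

theorem sum_law_fst [Fintype α] (p : Ω → ℝ) (A : Ω → α) (B : Ω → β) (b : β) :
    ∑ a, law p (fun ω => (A ω, B ω)) (a, b) = law p B b := by
  classical
  simp only [law_eq]
  rw [Finset.sum_comm]
  refine Finset.sum_congr rfl fun ω _ => ?_
  simp [Prod.mk.injEq, ite_and]

theorem sum_law_snd [Fintype β] (p : Ω → ℝ) (A : Ω → α) (B : Ω → β) (a : α) :
    ∑ b, law p (fun ω => (A ω, B ω)) (a, b) = law p A a := by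
  classical
  simp only [law_eq]
  rw [Finset.sum_comm]
  refine Finset.sum_congr rfl fun ω _ => ?_
  by_cases h : A ω = a <;> simp [Prod.mk.injEq, h]

theorem law_le_right [Fintype α] {p : Ω → ℝ} (hp : ∀ ω, 0 ≤ p ω) (A : Ω → α) (B : Ω → β)
    (a : α) (b : β) : law p (fun ω => (A ω, B ω)) (a, b) ≤ law p B b := by
  rw [← sum_law_fst p A B b]
  exact Finset.single_le_sum (f := fun a => law p (fun ω => (A ω, B ω)) (a, b))
    (fun a _ => law_nonneg hp _ _) (Finset.mem_univ a)

variable [Fintype α] [Fintype β] [Fintype γ]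

/-- The conditional mutual information in terms of joint entropies. -/
theorem condMutualInfo_eq {p : Ω → ℝ} (hp : ∀ ω, 0 ≤ p ω) (A : Ω → α) (B : Ω → β) (K : Ω → γ) :
    condMutualInfo p A B K =
      ((∑ a, ∑ k, Real.negMulLog (law p (fun ω => (A ω, K ω)) (a, k))) +
        (∑ b, ∑ k, Real.negMulLog (law p (fun ω => (B ω, K ω)) (b, k))) -
        (∑ a, ∑ b, ∑ k, Real.negMulLog (law p (fun ω => (A ω, B ω, K ω)) (a, b, k))) -
        ∑ k, Real.negMulLog (law p K k)) / Real.log 2 := by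
  set J : α → β → γ → ℝ := fun a b k => law p (fun ω => (A ω, B ω, K ω)) (a, b, k)
  have hAK : ∀ a k, law p (fun ω => (A ω, K ω)) (a, k) = ∑ b, J a b k := by
    intro a k
    rw [← sum_law_fst p B (fun ω => (A ω, K ω)) (a, k)]
    refine Finset.sum_congr rfl fun b _ => ?_
    classical
    simp only [J, law_eq, Prod.mk.injEq]
    refine Finset.sum_congr rfl fun ω _ => ?_
    congr 1
    simp only [eq_iff_iff]
    tauto
  have hBK : ∀ b k, law p (fun ω => (B ω, K ω)) (b, k) = ∑ a, J a b k := fun b k =>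
    (sum_law_fst p A (fun ω => (B ω, K ω)) (b, k)).symm
  have hK : ∀ k, law p K k = ∑ a, ∑ b, J a b k := by
    intro k
    rw [← sum_law_fst p A K k]
    exact Finset.sum_congr rfl fun a _ => hAK a k
  have hJ : ∀ a b k, 0 ≤ J a b k := fun a b k => law_nonneg hp _ _
  have hterm : ∀ a b k, J a b k * Real.logb 2 (J a b k * law p K k /
      (law p (fun ω => (A ω, K ω)) (a, k) * law p (fun ω => (B ω, K ω)) (b, k))) =
      (J a b k * Real.log (law p K k) - J a b k * Real.log (law p (fun ω => (A ω, K ω)) (a, k)) -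
        J a b k * Real.log (law p (fun ω => (B ω, K ω)) (b, k)) -
        Real.negMulLog (J a b k)) / Real.log 2 := by
    intro a b k
    rcases (hJ a b k).eq_or_lt with h0 | h0
    · simp [← h0]
    · have h2 : 0 < law p (fun ω => (B ω, K ω)) (b, k) :=
        h0.trans_le (law_le_right hp A (fun ω => (B ω, K ω)) a (b, k))
      have h3 : 0 < law p K k := h2.trans_le (law_le_right hp B K b k)
      have h1 : 0 < law p (fun ω => (A ω, K ω)) (a, k) := by
        rw [hAK]
        exact h0.trans_le (Finset.single_le_sum (f := fun b => J a b k) (fun b _ => hJ a b k)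
          (Finset.mem_univ b))
      rw [Real.logb, Real.log_div (mul_pos h0 h3).ne' (mul_pos h1 h2).ne',
        Real.log_mul h0.ne' h3.ne', Real.log_mul h1.ne' h2.ne', Real.negMulLog]
      ring
  have e1 : ∑ a, ∑ k, Real.negMulLog (law p (fun ω => (A ω, K ω)) (a, k)) =
      - ∑ a, ∑ b, ∑ k, J a b k * Real.log (law p (fun ω => (A ω, K ω)) (a, k)) := by
    rw [← Finset.sum_neg_distrib]
    refine Finset.sum_congr rfl fun a _ => ?_
    rw [Finset.sum_comm, ← Finset.sum_neg_distrib]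
    refine Finset.sum_congr rfl fun k _ => ?_
    rw [← Finset.sum_mul, ← hAK, Real.negMulLog, neg_mul]
  have e2 : ∑ b, ∑ k, Real.negMulLog (law p (fun ω => (B ω, K ω)) (b, k)) =
      - ∑ a, ∑ b, ∑ k, J a b k * Real.log (law p (fun ω => (B ω, K ω)) (b, k)) := by
    conv_rhs => rw [Finset.sum_comm]
    rw [← Finset.sum_neg_distrib]
    refine Finset.sum_congr rfl fun b _ => ?_
    rw [Finset.sum_comm, ← Finset.sum_neg_distrib]
    refine Finset.sum_congr rfl fun k _ => ?_
    rw [← Finset.sum_mul, ← hBK, Real.negMulLog, neg_mul]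
  have e3 : ∑ k, Real.negMulLog (law p K k) =
      - ∑ a, ∑ b, ∑ k, J a b k * Real.log (law p K k) := by
    have : ∀ a, ∑ b, ∑ k, J a b k * Real.log (law p K k) =
        ∑ k, (∑ b, J a b k) * Real.log (law p K k) := fun a => by
      rw [Finset.sum_comm]
      simp only [Finset.sum_mul]
    rw [Finset.sum_congr rfl fun a _ => this a, Finset.sum_comm, ← Finset.sum_neg_distrib]
    refine Finset.sum_congr rfl fun k _ => ?_
    rw [← Finset.sum_mul, ← hK, Real.negMulLog, neg_mul]
  rw [e1, e2, e3]
  unfold condMutualInfo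
  simp only [J] at hterm
  simp only [hterm, J, ← Finset.sum_div, Finset.sum_sub_distrib]
  ring

end Information

/-! ### Marginal channels and the entropy gap -/

section Gap

variable {X Y Z O : Type*} [Fintype X] [Fintype Y] [Fintype Z] [Fintype O]

/-- The marginal channel from `X` to `Y`. -/
def chanY (W : X → stdSimplex ℝ (Y × Z)) (x : X) (y : Y) : ℝ := ∑ z, W x (y, z)

/-- The marginal channel from `X` to `Z`. -/
def chanZ (W : X → stdSimplex ℝ (Y × Z)) (x : X) (z : Z) : ℝ := ∑ y, W x (y, z)

theorem chanY_nonneg (W : X → stdSimplex ℝ (Y × Z)) (x : X) (y : Y) : 0 ≤ chanY W x y :=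
  Finset.sum_nonneg fun _ _ => (W x).2.1 _

theorem chanZ_nonneg (W : X → stdSimplex ℝ (Y × Z)) (x : X) (z : Z) : 0 ≤ chanZ W x z :=
  Finset.sum_nonneg fun _ _ => (W x).2.1 _

theorem sum_chanY (W : X → stdSimplex ℝ (Y × Z)) (x : X) : ∑ y, chanY W x y = 1 := by
  rw [← (W x).2.2, Fintype.sum_prod_type]
  rfl

theorem sum_chanZ (W : X → stdSimplex ℝ (Y × Z)) (x : X) : ∑ z, chanZ W x z = 1 := by
  rw [← (W x).2.2, Fintype.sum_prod_type, Finset.sum_comm]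
  rfl

/-- The output measure of the channel `Γ` for the input measure `a`. -/
def push (Γ : X → O → ℝ) (a : X → ℝ) (o : O) : ℝ := ∑ x, a x * Γ x o

/-- The entropy functional (in nats) of a measure on a finite set. -/
def ent (q : O → ℝ) : ℝ := ∑ o, Real.negMulLog (q o)

theorem sum_push {Γ : X → O → ℝ} (hΓ : ∀ x, ∑ o, Γ x o = 1) (a : X → ℝ) :
    ∑ o, push Γ a o = ∑ x, a x := by
  unfold push
  rw [Finset.sum_comm]
  simp only [← Finset.mul_sum, hΓ, mul_one]

theorem push_smul (Γ : X → O → ℝ) (s : ℝ) (a : X → ℝ) : push Γ (s • a) = s • push Γ a := by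
  funext o
  simp [push, Finset.mul_sum, mul_assoc]

theorem push_sum {ι : Type*} (Γ : X → O → ℝ) (s : Finset ι) (a : ι → X → ℝ) :
    push Γ (∑ i ∈ s, a i) = ∑ i ∈ s, push Γ (a i) := by
  funext o
  simp only [push, Finset.sum_apply, Finset.sum_mul]
  exact Finset.sum_comm

theorem ent_smul (s : ℝ) (q : O → ℝ) :
    ent (s • q) = (∑ o, q o) * Real.negMulLog s + s * ent q := by
  simp only [ent, Pi.smul_apply, smul_eq_mul, Real.negMulLog_mul, Finset.sum_add_distrib,
    Finset.sum_mul, Finset.mul_sum]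

/-- The difference, in bits, of the entropies of the two outputs of the channel. -/
def entGap (W : X → stdSimplex ℝ (Y × Z)) (a : X → ℝ) : ℝ :=
  (ent (push (chanY W) a) - ent (push (chanZ W) a)) / Real.log 2

/-- Scaling adds mass times `Real.negMulLog s` to each entropy. Both channels preserve mass, so
these terms cancel in the difference. This allows joint measures to be used without normalizing them
to conditional laws. -/
theorem entGap_smul (W : X → stdSimplex ℝ (Y × Z)) (s : ℝ) (a : X → ℝ) :
    entGap W (s • a) = s * entGap W a := by
  simp only [entGap, push_smul, ent_smul, sum_push (sum_chanY W), sum_push (sum_chanZ W)]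
  ring

theorem entGap_zero (W : X → stdSimplex ℝ (Y × Z)) : entGap W 0 = 0 := by
  simpa using entGap_smul W 0 0

theorem continuous_entGap (W : X → stdSimplex ℝ (Y × Z)) : Continuous (entGap W) := by
  unfold entGap ent push
  have := Real.continuous_negMulLog
  fun_prop

end Gap

/-! ### The region of pairs of secrecy gain and cost -/

section Region

/-- The convex hull of a compact set in a finite-dimensional space is compact. -/
theorem isCompact_convexHull_of_isCompact {E : Type*} [AddCommGroup E] [Module ℝ E]
    [TopologicalSpace E] [IsTopologicalAddGroup E] [ContinuousSMul ℝ E] [FiniteDimensional ℝ E]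
    {s : Set E} (hs : IsCompact s) : IsCompact (convexHull ℝ s) := by
  classical
  rcases s.eq_empty_or_nonempty with rfl | ⟨z₀, hz₀⟩
  · simp
  set N := Module.finrank ℝ E + 1
  -- By Carathéodory, N = dim + 1 points suffice, so the hull is a continuous image of a compact
  -- product.
  have hc : IsCompact ((fun q : (Fin N → ℝ) × (Fin N → E) => ∑ i, q.1 i • q.2 i) ''
      (stdSimplex ℝ (Fin N) ×ˢ Set.pi Set.univ fun _ => s)) := by
    refine ((isCompact_stdSimplex ℝ (Fin N)).prod (isCompact_univ_pi fun _ => hs)).image ?_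
    fun_prop
  convert hc using 1
  apply Set.Subset.antisymm
  · intro x hx
    obtain ⟨ι, _, z, w, hz, hai, hw, hw1, hx⟩ := eq_pos_convex_span_of_mem_convexHull hx
    have hcard : Fintype.card ι ≤ N := by
      exact hai.card_le_finrank_succ.trans (by
        simpa [N] using Submodule.finrank_le _)
    obtain ⟨e⟩ : Nonempty (ι ↪ Fin N) := by
      rw [Function.Embedding.nonempty_iff_card_le]
      simpa using hcard
    -- Shorter combinations are padded with the point `z₀` at weight zero.
    refine ⟨(Function.extend e w 0, Function.extend e z fun _ => z₀), ⟨⟨?_, ?_⟩, ?_⟩, ?_⟩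
    · intro j
      by_cases hj : ∃ i, e i = j
      · obtain ⟨i, rfl⟩ := hj
        simp only [e.injective.extend_apply]
        exact (hw i).le
      · simp only [Function.extend_apply' _ _ _ hj]
        rfl
    · rw [← hw1]
      refine (Fintype.sum_of_injective e e.injective _ _ (fun j hj => ?_) fun i => ?_).symm
      · simp only [Function.extend_apply' _ _ _ hj]
        rfl
      · simp only [e.injective.extend_apply]
    · intro j _
      by_cases hj : ∃ i, e i = j
      · obtain ⟨i, rfl⟩ := hj
        simp only [e.injective.extend_apply]
        exact hz ⟨i, rfl⟩
      · simp only [Function.extend_apply' _ _ _ hj]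
        exact hz₀
    · rw [← hx]
      refine (Fintype.sum_of_injective e e.injective _ _ (fun j hj => ?_) fun i => ?_).symm
      · simp only [Function.extend_apply' _ _ _ hj, Pi.zero_apply, zero_smul]
      · simp only [e.injective.extend_apply]
  · rintro _ ⟨⟨w, z⟩, ⟨hw, hz⟩, rfl⟩
    exact mem_convexHull_of_exists_fintype w z hw.1 hw.2 (fun i => hz i trivial) rfl

variable {X Y Z : Type*} [Fintype X] [Fintype Y] [Fintype Z]

/-- The convex hull of the graph of the entropy gap over the input laws. -/
def gapHull (W : X → stdSimplex ℝ (Y × Z)) : Set ((X → ℝ) × ℝ) :=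
  convexHull ℝ ((fun p => (p, entGap W p)) '' stdSimplex ℝ X)

/-- The gain and the cost of a point of `gapHull`. -/
def gainCost (W : X → stdSimplex ℝ (Y × Z)) (C : X → ℝ) (q : (X → ℝ) × ℝ) : ℝ × ℝ :=
  (entGap W q.1 - q.2, ∑ x, q.1 x * C x)

/-- The set of pairs of a secrecy gain and an expected cost. -/
def region (W : X → stdSimplex ℝ (Y × Z)) (C : X → ℝ) : Set (ℝ × ℝ) :=
  convexHull ℝ (gainCost W C '' gapHull W)

theorem isCompact_region (W : X → stdSimplex ℝ (Y × Z)) (C : X → ℝ) :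
    IsCompact (region W C) := by
  have h := continuous_entGap W
  refine isCompact_convexHull_of_isCompact (IsCompact.image ?_ ?_)
  · refine isCompact_convexHull_of_isCompact (IsCompact.image (isCompact_stdSimplex ℝ X) ?_)
    fun_prop
  · unfold gainCost
    fun_prop

/-- A deterministic input has no gain. Such points show that the feasible part is nonempty and, when
mixed in, buy slack in the cost constraint. -/
theorem zero_gain_mem_region (W : X → stdSimplex ℝ (Y × Z)) (C : X → ℝ) (x : X) :
    (0, C x) ∈ region W C := by
  classical
  refine subset_convexHull ℝ _ ⟨(Pi.single x 1, entGap W (Pi.single x 1)), ?_, ?_⟩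
  · exact subset_convexHull ℝ _ ⟨_, single_mem_stdSimplex ℝ x, rfl⟩
  · simp [gainCost, Pi.single_apply]

/-- The cone over the region, whose second coordinate is the total mass. -/
def regionCone (W : X → stdSimplex ℝ (Y × Z)) (C : X → ℝ) : Set (ℝ × ℝ × ℝ) :=
  {t | 0 ≤ t.2.1 ∧ ∃ q ∈ region W C, t.1 = t.2.1 * q.1 ∧ t.2.2 = t.2.1 * q.2}

variable [Nonempty X]

theorem zero_mem_regionCone (W : X → stdSimplex ℝ (Y × Z)) (C : X → ℝ) :
    0 ∈ regionCone W C := by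
  obtain ⟨x⟩ := ‹Nonempty X›
  exact ⟨le_rfl, _, zero_gain_mem_region W C x, by simp, by simp⟩

omit [Nonempty X] in
-- Normalized by mass, the sum is a weighted average of two points of the convex set `region`. A
-- summand of mass zero is itself zero.
theorem add_mem_regionCone {W : X → stdSimplex ℝ (Y × Z)} {C : X → ℝ} {s t : ℝ × ℝ × ℝ}
    (hs : s ∈ regionCone W C) (ht : t ∈ regionCone W C) : s + t ∈ regionCone W C := by
  obtain ⟨hs0, q, hq, h1, h2⟩ := hs
  obtain ⟨ht0, q', hq', h1', h2'⟩ := ht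
  rcases hs0.eq_or_lt with h | h
  · refine ⟨by simpa using add_nonneg hs0 ht0, q', hq', ?_, ?_⟩
    · simp [h1, h1', ← h]
    · simp [h2, h2', ← h]
  have hpos : 0 < s.2.1 + t.2.1 := by linarith
  refine ⟨hpos.le, (s.2.1 / (s.2.1 + t.2.1)) • q + (t.2.1 / (s.2.1 + t.2.1)) • q',
    (convex_convexHull ℝ _) hq hq' (by positivity) (by positivity) (by field_simp), ?_, ?_⟩
  · simp only [Prod.fst_add, Prod.snd_add, Prod.smul_fst, smul_eq_mul, h1, h1']
    field_simp
  · simp only [Prod.snd_add, Prod.smul_snd, Prod.fst_add, smul_eq_mul, h2, h2']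
    field_simp

theorem sum_mem_regionCone {W : X → stdSimplex ℝ (Y × Z)} {C : X → ℝ} {ι : Type*}
    (s : Finset ι) (t : ι → ℝ × ℝ × ℝ) (ht : ∀ i ∈ s, t i ∈ regionCone W C) :
    ∑ i ∈ s, t i ∈ regionCone W C := by
  classical
  induction s using Finset.induction_on with
  | empty => simpa using zero_mem_regionCone W C
  | insert i s hi ih =>
    rw [Finset.sum_insert hi]
    exact add_mem_regionCone (ht i (Finset.mem_insert_self i s))
      (ih fun j hj => ht j (Finset.mem_insert_of_mem hj))

omit [Nonempty X] in
theorem mem_region_of_mem_regionCone {W : X → stdSimplex ℝ (Y × Z)} {C : X → ℝ} {r s c : ℝ}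
    (hs : 0 < s) (h : (r, s, c) ∈ regionCone W C) : (r / s, c / s) ∈ region W C := by
  obtain ⟨_, q, hq, h1, h2⟩ := h
  simp only at h1 h2
  rw [h1, h2, mul_div_cancel_left₀ _ hs.ne', mul_div_cancel_left₀ _ hs.ne']
  exact hq

/-- The splitting of an input measure into parts yields a point of the cone. -/
theorem split_mem_regionCone (W : X → stdSimplex ℝ (Y × Z)) (C : X → ℝ) {M : Type*} [Fintype M]
    {a : M → X → ℝ} (ha : ∀ m x, 0 ≤ a m x) :
    (entGap W (∑ m, a m) - ∑ m, entGap W (a m), ∑ m, ∑ x, a m x, ∑ m, ∑ x, a m x * C x) ∈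
      regionCone W C := by
  classical
  set w : M → ℝ := fun m => ∑ x, a m x with hw
  have hw0 : ∀ m, 0 ≤ w m := fun m => Finset.sum_nonneg fun x _ => ha m x
  have hzero : ∀ m, w m = 0 → a m = 0 := by
    intro m hm
    funext x
    exact (Finset.sum_eq_zero_iff_of_nonneg fun x _ => ha m x).1 hm x (Finset.mem_univ x)
  rcases (Finset.sum_nonneg fun m (_ : m ∈ Finset.univ) => hw0 m).eq_or_lt with h0 | h0
  · have h1 : ∀ m, a m = 0 := fun m =>
      hzero m ((Finset.sum_eq_zero_iff_of_nonneg fun m _ => hw0 m).1 h0.symm m (Finset.mem_univ m))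
    have : a = 0 := funext h1
    rw [← h0]
    simp only [this, Pi.zero_apply, Finset.sum_const_zero, entGap_zero, sub_zero, zero_mul]
    exact zero_mem_regionCone W C
  set s := ∑ m, w m
  obtain ⟨x₀⟩ := ‹Nonempty X›
  -- The parts are normalized to laws. A part of mass zero receives an arbitrary point mass, which
  -- enters with weight zero.
  set p : M → X → ℝ := fun m => if w m = 0 then Pi.single x₀ 1 else (w m)⁻¹ • a m with hp
  have hp1 : ∀ m, p m ∈ stdSimplex ℝ X := by
    intro m
    simp only [hp]
    split_ifs with h
    · exact single_mem_stdSimplex ℝ x₀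
    · refine ⟨fun x => ?_, ?_⟩
      · simpa using mul_nonneg (inv_nonneg.2 (hw0 m)) (ha m x)
      · simp only [Pi.smul_apply, smul_eq_mul, ← Finset.mul_sum]
        exact inv_mul_cancel₀ h
  have hap : ∀ m, a m = w m • p m := by
    intro m
    simp only [hp]
    split_ifs with h
    · simp [h, hzero m h]
    · rw [smul_inv_smul₀ h]
  have hsum : ∑ m, a m = s • ∑ m, (w m / s) • p m := by
    rw [Finset.smul_sum]
    refine Finset.sum_congr rfl fun m _ => ?_
    rw [smul_smul, mul_div_cancel₀ _ h0.ne', ← hap]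
  have hmem : ∑ m, (w m / s) • (p m, entGap W (p m)) ∈ gapHull W := by
    refine (convex_convexHull ℝ _).sum_mem (fun m _ => div_nonneg (hw0 m) h0.le) ?_ fun m _ => ?_
    · rw [← Finset.sum_div]
      exact div_self h0.ne'
    · exact subset_convexHull ℝ _ ⟨p m, hp1 m, rfl⟩
  refine ⟨h0.le, gainCost W C (∑ m, (w m / s) • (p m, entGap W (p m))),
    subset_convexHull ℝ _ ⟨_, hmem, rfl⟩, ?_, ?_⟩
  · have h1 : ∀ m, entGap W (a m) = w m * entGap W (p m) := fun m => by
      conv_lhs => rw [hap m]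
      rw [entGap_smul]
    simp only [gainCost, Prod.fst_sum, Prod.snd_sum, Prod.smul_fst, Prod.smul_snd, smul_eq_mul, h1]
    rw [hsum, entGap_smul, mul_sub, Finset.mul_sum]
    congr 1
    refine Finset.sum_congr rfl fun m _ => ?_
    field_simp
  · simp only [gainCost, Prod.fst_sum, Prod.smul_fst]
    rw [Finset.mul_sum, Finset.sum_comm]
    refine Finset.sum_congr rfl fun x _ => ?_
    have := congrFun hsum x
    simp only [Finset.sum_apply, Pi.smul_apply, smul_eq_mul] at this ⊢
    rw [← Finset.sum_mul, this]
    ring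

end Region

/-! ### The single-letter expression in terms of the region -/

section SingleLetter

variable {U V X Y Z : Type*} [Fintype U] [Fintype V] [Fintype X] [Fintype Y] [Fintype Z]

theorem throughChannel_nonneg (W : X → stdSimplex ℝ (Y × Z)) (P : stdSimplex ℝ (U × V × X))
    (ω : U × V × X × Y × Z) : 0 ≤ throughChannel W P ω :=
  mul_nonneg (P.2.1 _) ((W _).2.1 _)

theorem law_throughChannel_Y (W : X → stdSimplex ℝ (Y × Z)) (P : stdSimplex ℝ (U × V × X))
    (v : V) (y : Y) (u : U) :
    law (throughChannel W P) (fun ω => (ω.2.1, ω.2.2.2.1, ω.1)) (v, y, u) =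
      push (chanY W) (fun x => P (u, v, x)) y := by
  classical
  simp only [law_eq, Fintype.sum_prod_type, throughChannel, Prod.mk.injEq, ite_and]
  simp only [Finset.sum_ite_irrel, Finset.sum_const_zero, Finset.sum_ite_eq', Finset.mem_univ,
    if_true, push, chanY, Finset.mul_sum]

theorem law_throughChannel_Z (W : X → stdSimplex ℝ (Y × Z)) (P : stdSimplex ℝ (U × V × X))
    (v : V) (z : Z) (u : U) :
    law (throughChannel W P) (fun ω => (ω.2.1, ω.2.2.2.2, ω.1)) (v, z, u) =
      push (chanZ W) (fun x => P (u, v, x)) z := by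
  classical
  simp only [law_eq, Fintype.sum_prod_type, throughChannel, Prod.mk.injEq, ite_and]
  simp only [Finset.sum_ite_irrel, Finset.sum_const_zero, Finset.sum_ite_eq', Finset.mem_univ,
    if_true, push, chanZ, Finset.mul_sum]

theorem sum_rotate {α β γ : Type*} [Fintype α] [Fintype β] [Fintype γ] (f : α → β → γ → ℝ) :
    ∑ a, ∑ b, ∑ c, f a b c = ∑ c, ∑ a, ∑ b, f a b c := by
  rw [Finset.sum_congr rfl fun a _ => Finset.sum_comm, Finset.sum_comm]

/-- In the entropy form of the two informations, the terms H(U, V) and H(U) are common to Y and Z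
and cancel. -/
theorem secrecyGain_eq (W : X → stdSimplex ℝ (Y × Z)) (P : stdSimplex ℝ (U × V × X)) :
    secrecyGain W P = ∑ u, (entGap W (∑ v, fun x => P (u, v, x)) -
      ∑ v, entGap W (fun x => P (u, v, x))) := by
  have hY : ∀ y u, law (throughChannel W P) (fun ω => (ω.2.2.2.1, ω.1)) (y, u) =
      push (chanY W) (∑ v, fun x => P (u, v, x)) y := by
    intro y u
    rw [push_sum, Finset.sum_apply,
      ← sum_law_fst (throughChannel W P) (fun ω => ω.2.1) (fun ω => (ω.2.2.2.1, ω.1))]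
    exact Finset.sum_congr rfl fun v _ => law_throughChannel_Y W P v y u
  have hZ : ∀ z u, law (throughChannel W P) (fun ω => (ω.2.2.2.2, ω.1)) (z, u) =
      push (chanZ W) (∑ v, fun x => P (u, v, x)) z := by
    intro z u
    rw [push_sum, Finset.sum_apply,
      ← sum_law_fst (throughChannel W P) (fun ω => ω.2.1) (fun ω => (ω.2.2.2.2, ω.1))]
    exact Finset.sum_congr rfl fun v _ => law_throughChannel_Z W P v z u
  rw [secrecyGain, condMutualInfo_eq (throughChannel_nonneg W P),
    condMutualInfo_eq (throughChannel_nonneg W P)]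
  simp only [law_throughChannel_Y, law_throughChannel_Z, hY, hZ]
  rw [Finset.sum_comm (s := (Finset.univ : Finset Y)),
    Finset.sum_comm (s := (Finset.univ : Finset Z)),
    sum_rotate (β := Y), sum_rotate (β := Z)]
  simp only [entGap, ent, Finset.sum_sub_distrib, ← Finset.sum_div]
  ring

variable [Nonempty X]

/-- Each feasible law gives a point of the region. -/
theorem mem_region_of_law (W : X → stdSimplex ℝ (Y × Z)) (C : X → ℝ)
    (P : stdSimplex ℝ (U × V × X)) :
    (secrecyGain W P, ∑ u, ∑ v, ∑ x, P (u, v, x) * C x) ∈ region W C := by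
  have h := sum_mem_regionCone Finset.univ _ fun u _ =>
    split_mem_regionCone W C (a := fun v x => P (u, v, x)) fun v x => P.2.1 _
  have h1 : ∑ u, ∑ v, ∑ x, P (u, v, x) = 1 := by
    rw [← P.2.2]
    simp only [Fintype.sum_prod_type]
    rfl
  have h2 : (secrecyGain W P, (1 : ℝ), ∑ u, ∑ v, ∑ x, P (u, v, x) * C x) ∈ regionCone W C := by
    convert h using 1
    refine Prod.ext ?_ (Prod.ext ?_ ?_)
    · simp only [Prod.fst_sum]
      exact secrecyGain_eq W P
    · simp only [Prod.fst_sum, Prod.snd_sum]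
      exact h1.symm
    · simp only [Prod.snd_sum]
  simpa using mem_region_of_mem_regionCone one_pos h2

/-- Each point of the region is realized by a law of `(U, V)` and a channel from `V` to `X`,
such that each letter of `V` has positive probability. -/
theorem exists_law_of_mem_region {W : X → stdSimplex ℝ (Y × Z)} {C : X → ℝ} {q : ℝ × ℝ}
    (hq : q ∈ region W C) :
    ∃ (k l : ℕ) (lam : stdSimplex ℝ (Fin k)) (κ : Fin k → stdSimplex ℝ (Fin l))
      (K : Fin l → stdSimplex ℝ X), (∀ v, ∃ u, 0 < lam u * κ u v) ∧
      q.1 = ∑ u, lam u * (entGap W (∑ v, κ u v • (K v : X → ℝ)) - ∑ v, κ u v * entGap W (K v)) ∧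
      q.2 = ∑ u, ∑ v, lam u * κ u v * ∑ x, K v x * C x := by
  classical
  -- The outer convex combination is read as the law of U, the inner ones as the laws of V given U.
  obtain ⟨ι, _, z, w, hz, -, hw, hw1, hq⟩ := eq_pos_convex_span_of_mem_convexHull hq
  have h1 : ∀ i, ∃ t ∈ gapHull W, gainCost W C t = z i := fun i => hz ⟨i, rfl⟩
  choose t ht htz using h1
  have h2 := fun i => eq_pos_convex_span_of_mem_convexHull (ht i)
  choose J fJ g μ hg _ hμ hμ1 hgt using h2
  have h3 : ∀ i j, ∃ p ∈ stdSimplex ℝ X, (p, entGap W p) = g i j := fun i j => hg i ⟨j, rfl⟩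
  choose p hp hpg using h3
  have ht1 : ∀ i, (t i).1 = ∑ j, μ i j • p i j := fun i => by
    rw [← hgt i, Prod.fst_sum]
    exact Finset.sum_congr rfl fun j _ => by rw [← hpg]; rfl
  have ht2 : ∀ i, (t i).2 = ∑ j, μ i j * entGap W (p i j) := fun i => by
    rw [← hgt i, Prod.snd_sum]
    exact Finset.sum_congr rfl fun j _ => by rw [← hpg]; rfl
  let eU := Fintype.equivFin ι
  let eV := Fintype.equivFin (Σ i, J i)
  -- The alphabet of V is a disjoint union over u, so V determines U. The input law then depends on
  -- V alone, and strictly positive weights give each letter of V positive probability.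
  let κ₀ : ι → (Σ i, J i) → ℝ := fun i s => if s.1 = i then μ s.1 s.2 else 0
  have hκ : ∀ i (f : (Σ i, J i) → ℝ), ∑ s, κ₀ i s * f s = ∑ j, μ i j * f ⟨i, j⟩ := by
    intro i f
    rw [Fintype.sum_sigma, Finset.sum_eq_single i]
    · simp [κ₀]
    · intro i' _ hi'
      simp [κ₀, hi']
    · simp
  refine ⟨Fintype.card ι, Fintype.card (Σ i, J i), ⟨fun a => w (eU.symm a), fun a => (hw _).le, ?_⟩,
    fun a => ⟨fun s => κ₀ (eU.symm a) (eV.symm s), fun s => ?_, ?_⟩,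
    fun s => ⟨p (eV.symm s).1 (eV.symm s).2, hp _ _⟩, ?_, ?_, ?_⟩
  · rw [← hw1]
    exact eU.symm.sum_comp w
  · simp only [κ₀]
    split_ifs
    exacts [(hμ _ _).le, le_rfl]
  · rw [eV.symm.sum_comp (κ₀ (eU.symm a)), ← hμ1 (eU.symm a)]
    simpa using hκ (eU.symm a) 1
  · intro s
    refine ⟨eU (eV.symm s).1, ?_⟩
    change 0 < w (eU.symm (eU (eV.symm s).1)) * κ₀ (eU.symm (eU (eV.symm s).1)) (eV.symm s)
    simp only [Equiv.symm_apply_apply, κ₀, if_true]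
    exact mul_pos (hw _) (hμ _ _)
  · rw [← hq, Prod.fst_sum, ← eU.symm.sum_comp]
    refine Finset.sum_congr rfl fun a _ => ?_
    change w (eU.symm a) * (z (eU.symm a)).1 = w (eU.symm a) * (entGap W (∑ s,
      κ₀ (eU.symm a) (eV.symm s) • p (eV.symm s).1 (eV.symm s).2) -
      ∑ s, κ₀ (eU.symm a) (eV.symm s) * entGap W (p (eV.symm s).1 (eV.symm s).2))
    rw [eV.symm.sum_comp fun s => κ₀ (eU.symm a) s • p s.1 s.2,
      eV.symm.sum_comp fun s => κ₀ (eU.symm a) s * entGap W (p s.1 s.2),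
      hκ _ fun s => entGap W (p s.1 s.2), ← htz, gainCost, ht1, ht2]
    have hmix : ∑ s, κ₀ (eU.symm a) s • p s.1 s.2 = ∑ j, μ (eU.symm a) j • p (eU.symm a) j := by
      funext x
      simp only [Finset.sum_apply, Pi.smul_apply, smul_eq_mul]
      exact hκ _ fun s => p s.1 s.2 x
    rw [hmix]
  · rw [← hq, Prod.snd_sum, ← eU.symm.sum_comp]
    refine Finset.sum_congr rfl fun a _ => ?_
    change w (eU.symm a) * (z (eU.symm a)).2 = ∑ s, w (eU.symm a) *
      κ₀ (eU.symm a) (eV.symm s) * ∑ x, p (eV.symm s).1 (eV.symm s).2 x * C x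
    simp only [mul_assoc]
    rw [← Finset.mul_sum, eV.symm.sum_comp fun s => κ₀ (eU.symm a) s * ∑ x, p s.1 s.2 x * C x,
      hκ _ fun s => ∑ x, p s.1 s.2 x * C x, ← htz]
    simp only [gainCost, ht1, Finset.sum_apply, Pi.smul_apply, smul_eq_mul, Finset.sum_mul,
      Finset.mul_sum, mul_assoc]
    rw [Finset.sum_comm]

/-- Each point of the region of cost at most `b` is realized by a feasible law. -/
theorem mem_secrecyGains_of_mem_region {W : X → stdSimplex ℝ (Y × Z)} {C : X → ℝ} {q : ℝ × ℝ}
    (hq : q ∈ region W C) {b : ℝ} (hb : q.2 ≤ b) : q.1 ∈ secrecyGains W C b := by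
  obtain ⟨k, l, lam, κ, K, -, h1, h2⟩ := exists_law_of_mem_region hq
  have hK : ∀ v, ∑ x, K v x = 1 := fun v => (K v).2.2
  have hκ : ∀ u, ∑ v, κ u v = 1 := fun u => (κ u).2.2
  have hl : ∑ u, lam u = 1 := lam.2.2
  let P : stdSimplex ℝ (Fin k × Fin l × X) := ⟨fun t => lam t.1 * κ t.1 t.2.1 * K t.2.1 t.2.2,
    fun t => mul_nonneg (mul_nonneg (lam.2.1 _) ((κ _).2.1 _)) ((K _).2.1 _), by
      simp only [Fintype.sum_prod_type, ← Finset.mul_sum, hK, mul_one, hκ, hl]⟩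
  have hP : ∀ u v x, P (u, v, x) = lam u * κ u v * K v x := fun _ _ _ => rfl
  refine ⟨k, l, P, ⟨⟨K, fun u v x => ?_⟩, ?_⟩, ?_⟩
  · simp only [hP, ← Finset.mul_sum, hK, mul_one]
  · refine le_trans (le_of_eq ?_) hb
    rw [h2]
    simp only [hP, Finset.mul_sum, mul_assoc]
  · have e1 : ∀ u v, (fun x => P (u, v, x)) = lam u • κ u v • (K v : X → ℝ) := fun u v => by
      funext x
      simp [hP, mul_assoc]
    rw [secrecyGain_eq, h1]
    refine Finset.sum_congr rfl fun u _ => ?_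
    simp only [e1, ← Finset.smul_sum, entGap_smul, mul_sub, Finset.mul_sum]

/-- The supremum in the single-letter expression is a maximum. -/
theorem isGreatest_singleLetter (W : X → stdSimplex ℝ (Y × Z)) (C : X → ℝ) {b : ℝ}
    (hb : ∃ x, C x ≤ b) : IsGreatest (secrecyGains W C b) (singleLetter W C b) := by
  obtain ⟨x, hx⟩ := hb
  have hc : IsCompact (region W C ∩ {q | q.2 ≤ b}) :=
    (isCompact_region W C).inter_right (isClosed_le continuous_snd continuous_const)
  obtain ⟨q, hq, hmax⟩ := hc.exists_isMaxOn ⟨_, zero_gain_mem_region W C x, hx⟩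
    continuous_fst.continuousOn
  have h : IsGreatest (secrecyGains W C b) q.1 := by
    refine ⟨mem_secrecyGains_of_mem_region hq.1 hq.2, ?_⟩
    rintro _ ⟨k, l, P, hP, rfl⟩
    exact hmax (⟨mem_region_of_law W C P, hP.2⟩ : _ ∈ region W C ∩ {q | q.2 ≤ b})
  have he : singleLetter W C b = q.1 := h.csSup_eq
  rw [he]
  exact h

theorem le_singleLetter_of_mem_region {W : X → stdSimplex ℝ (Y × Z)} {C : X → ℝ} {b : ℝ}
    (hb : ∃ x, C x ≤ b) {q : ℝ × ℝ} (hq : q ∈ region W C) (h : q.2 ≤ b) :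
    q.1 ≤ singleLetter W C b :=
  (isGreatest_singleLetter W C hb).2 (mem_secrecyGains_of_mem_region hq h)

theorem exists_mem_region_singleLetter (W : X → stdSimplex ℝ (Y × Z)) (C : X → ℝ) {b : ℝ}
    (hb : ∃ x, C x ≤ b) : ∃ q ∈ region W C, q.1 = singleLetter W C b ∧ q.2 ≤ b := by
  obtain ⟨k, l, P, hP, h⟩ := (isGreatest_singleLetter W C hb).1
  exact ⟨_, mem_region_of_law W C P, h.symm, hP.2⟩

end SingleLetter

/-! ### Reduction of the block entropy gap to single letters -/

section Block

variable {X Y Z : Type*} [Fintype X] [Fintype Y] [Fintype Z]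

/-- The memoryless extension of the marginal channel from `X` to `Z`. -/
def eavesPow (W : X → stdSimplex ℝ (Y × Z)) {n : ℕ} (x : Fin n → X) (z : Fin n → Z) : ℝ :=
  ∏ i, chanZ W (x i) (z i)

theorem mainPow_eq (W : X → stdSimplex ℝ (Y × Z)) {n : ℕ} (x : Fin n → X) (y : Fin n → Y) :
    mainPow W x y = ∏ i, chanY W (x i) (y i) := rfl

theorem mainPow_nonneg (W : X → stdSimplex ℝ (Y × Z)) {n : ℕ} (x : Fin n → X) (y : Fin n → Y) :
    0 ≤ mainPow W x y := Finset.prod_nonneg fun _ _ => chanY_nonneg W _ _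

theorem eavesPow_nonneg (W : X → stdSimplex ℝ (Y × Z)) {n : ℕ} (x : Fin n → X) (z : Fin n → Z) :
    0 ≤ eavesPow W x z := Finset.prod_nonneg fun _ _ => chanZ_nonneg W _ _

theorem sum_mainPow (W : X → stdSimplex ℝ (Y × Z)) {n : ℕ} (x : Fin n → X) :
    ∑ y, mainPow W x y = 1 := by
  simp only [mainPow_eq, sum_pi_prod fun i => chanY W (x i), sum_chanY, Finset.prod_const_one]

theorem sum_eavesPow (W : X → stdSimplex ℝ (Y × Z)) {n : ℕ} (x : Fin n → X) :
    ∑ z, eavesPow W x z = 1 := by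
  simp only [eavesPow, sum_pi_prod fun i => chanZ W (x i), sum_chanZ, Finset.prod_const_one]

/-- The difference, in bits, of the entropies of the two outputs of the memoryless extension. -/
def blockGap (W : X → stdSimplex ℝ (Y × Z)) {n : ℕ} (p : (Fin n → X) → ℝ) : ℝ :=
  (ent (push (mainPow W) p) - ent (push (eavesPow W) p)) / Real.log 2

theorem blockGap_smul (W : X → stdSimplex ℝ (Y × Z)) {n : ℕ} (s : ℝ) (p : (Fin n → X) → ℝ) :
    blockGap W (s • p) = s * blockGap W p := by
  simp only [blockGap, push_smul, ent_smul, sum_push (sum_mainPow W), sum_push (sum_eavesPow W)]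
  ring

/-- The joint measure of the later input letters and the first output letter `y`. -/
def headY (W : X → stdSimplex ℝ (Y × Z)) {n : ℕ} (p : (Fin (n + 1) → X) → ℝ) (y : Y)
    (x : Fin n → X) : ℝ := ∑ a, p (Fin.cons a x) * chanY W a y

/-- The joint measure of the first input letter and the later output letters `z`. -/
def tailZ (W : X → stdSimplex ℝ (Y × Z)) {n : ℕ} (p : (Fin (n + 1) → X) → ℝ) (z : Fin n → Z)
    (a : X) : ℝ := ∑ x : Fin n → X, p (Fin.cons a x) * eavesPow W x z

theorem headY_sum (W : X → stdSimplex ℝ (Y × Z)) {n : ℕ} {ι : Type*} (s : Finset ι)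
    (p : ι → (Fin (n + 1) → X) → ℝ) (y : Y) :
    headY W (∑ i ∈ s, p i) y = ∑ i ∈ s, headY W (p i) y := by
  funext x
  simp only [headY, Finset.sum_apply, Finset.sum_mul]
  exact Finset.sum_comm

theorem tailZ_sum (W : X → stdSimplex ℝ (Y × Z)) {n : ℕ} {ι : Type*} (s : Finset ι)
    (p : ι → (Fin (n + 1) → X) → ℝ) (z : Fin n → Z) :
    tailZ W (∑ i ∈ s, p i) z = ∑ i ∈ s, tailZ W (p i) z := by
  funext x
  simp only [tailZ, Finset.sum_apply, Finset.sum_mul]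
  exact Finset.sum_comm

theorem sum_headY (W : X → stdSimplex ℝ (Y × Z)) {n : ℕ} (p : (Fin (n + 1) → X) → ℝ)
    (f : (Fin n → X) → ℝ) :
    ∑ y, ∑ x, headY W p y x * f x = ∑ a, ∑ x : Fin n → X, p (Fin.cons a x) * f x := by
  rw [Finset.sum_comm, Finset.sum_comm (s := (Finset.univ : Finset X))]
  refine Finset.sum_congr rfl fun x _ => ?_
  simp only [headY, Finset.sum_mul]
  rw [Finset.sum_comm]
  refine Finset.sum_congr rfl fun a _ => ?_
  rw [← Finset.sum_mul, ← Finset.mul_sum, sum_chanY, mul_one]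

theorem sum_tailZ (W : X → stdSimplex ℝ (Y × Z)) {n : ℕ} (p : (Fin (n + 1) → X) → ℝ)
    (f : X → ℝ) :
    ∑ z, ∑ a, tailZ W p z a * f a = ∑ a, ∑ x : Fin n → X, p (Fin.cons a x) * f a := by
  rw [Finset.sum_comm]
  refine Finset.sum_congr rfl fun a _ => ?_
  simp only [tailZ, Finset.sum_mul]
  rw [Finset.sum_comm]
  refine Finset.sum_congr rfl fun x _ => ?_
  rw [← Finset.sum_mul, ← Finset.mul_sum, sum_eavesPow, mul_one]

/-- With Y₁, Z₁ the first letters and Y', Z' the rest, H(Y₁,Y') - H(Z₁,Z') is the sum of H(Y₁,Y') -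
H(Y₁,Z') and H(Y₁,Z') - H(Z₁,Z'). The first difference is a shorter block gap for each value of Y₁,
the second a one-letter gap for each value of Z'. -/
theorem blockGap_succ (W : X → stdSimplex ℝ (Y × Z)) {n : ℕ} (p : (Fin (n + 1) → X) → ℝ) :
    blockGap W p = ∑ y, blockGap W (headY W p y) + ∑ z, entGap W (tailZ W p z) := by
  have h1 : ent (push (mainPow W) p) = ∑ y, ent (push (mainPow W) (headY W p y)) := by
    unfold ent
    rw [sum_fin_succ_pi]
    refine Finset.sum_congr rfl fun y _ => Finset.sum_congr rfl fun y' _ => ?_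
    congr 1
    simp only [push, sum_fin_succ_pi (n := n), headY, Finset.sum_mul]
    rw [Finset.sum_comm]
    refine Finset.sum_congr rfl fun x _ => Finset.sum_congr rfl fun a _ => ?_
    rw [mainPow_eq, mainPow_eq, Fin.prod_univ_succ]
    simp only [Fin.cons_zero, Fin.cons_succ]
    ring
  have h2 : ent (push (eavesPow W) p) = ∑ z, ent (push (chanZ W) (tailZ W p z)) := by
    unfold ent
    rw [sum_fin_succ_pi, Finset.sum_comm]
    refine Finset.sum_congr rfl fun z _ => Finset.sum_congr rfl fun z' _ => ?_
    congr 1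
    simp only [push, sum_fin_succ_pi (n := n), tailZ, Finset.sum_mul]
    refine Finset.sum_congr rfl fun x _ => Finset.sum_congr rfl fun a _ => ?_
    rw [eavesPow, eavesPow, Fin.prod_univ_succ]
    simp only [Fin.cons_zero, Fin.cons_succ]
    ring
  -- Both sides are the inserted entropy H(Y₁,Z').
  have h3 : ∑ y, ent (push (eavesPow W) (headY W p y)) =
      ∑ z, ent (push (chanY W) (tailZ W p z)) := by
    unfold ent
    rw [Finset.sum_comm]
    refine Finset.sum_congr rfl fun z _ => Finset.sum_congr rfl fun y _ => ?_
    congr 1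
    simp only [push, headY, tailZ, Finset.sum_mul]
    rw [Finset.sum_comm]
    refine Finset.sum_congr rfl fun x _ => Finset.sum_congr rfl fun a _ => ?_
    ring
  simp only [blockGap, entGap, h1, h2, ← Finset.sum_div, Finset.sum_sub_distrib, h3]
  ring

theorem blockGap_of_isEmpty (W : X → stdSimplex ℝ (Y × Z)) (p : (Fin 0 → X) → ℝ) :
    blockGap W p = 0 := by
  simp [blockGap, ent, push, mainPow, eavesPow]

variable [Nonempty X]

/-- The splitting of a measure on input sequences into parts yields a point of the cone. -/
theorem block_split_mem_regionCone (W : X → stdSimplex ℝ (Y × Z)) (C : X → ℝ) {M : Type*}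
    [Fintype M] (n : ℕ) {p : M → (Fin n → X) → ℝ} (hp : ∀ m x, 0 ≤ p m x) :
    (blockGap W (∑ m, p m) - ∑ m, blockGap W (p m), n * ∑ m, ∑ x, p m x,
      ∑ m, ∑ x, p m x * ∑ i, C (x i)) ∈ regionCone W C := by
  induction n with
  | zero =>
    simp only [blockGap_of_isEmpty, Finset.univ_eq_empty, Finset.sum_empty, mul_zero,
      Finset.sum_const_zero, sub_zero, Nat.cast_zero, zero_mul]
    exact zero_mem_regionCone W C
  | succ n ih =>
    -- For each fixed y the later letters contribute n times their mass. For each fixed z below, the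
    -- first letter contributes its mass once, which gives n + 1 in total.
    have h1 := sum_mem_regionCone Finset.univ _ fun y _ =>
      ih (p := fun m => headY W (p m) y) fun m x =>
        Finset.sum_nonneg fun a _ => mul_nonneg (hp _ _) (chanY_nonneg W _ _)
    have h2 := sum_mem_regionCone Finset.univ _ fun z _ =>
      split_mem_regionCone W C (a := fun m => tailZ W (p m) z) fun m a =>
        Finset.sum_nonneg fun x _ => mul_nonneg (hp _ _) (eavesPow_nonneg W _ _)
    have h := add_mem_regionCone h1 h2
    convert h using 1
    refine Prod.ext ?_ (Prod.ext ?_ ?_)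
    · simp only [Prod.fst_add, Prod.fst_sum, blockGap_succ, headY_sum, tailZ_sum,
        Finset.sum_sub_distrib, Finset.sum_add_distrib]
      rw [Finset.sum_comm (s := (Finset.univ : Finset M)),
        Finset.sum_comm (s := (Finset.univ : Finset M))]
      ring
    · simp only [Prod.fst_add, Prod.fst_sum, Prod.snd_add, Prod.snd_sum, ← Finset.mul_sum]
      rw [Finset.sum_comm (t := (Finset.univ : Finset M)),
        Finset.sum_comm (t := (Finset.univ : Finset M))]
      have e1 := fun m => sum_headY W (p m) 1
      have e2 := fun m => sum_tailZ W (p m) 1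
      simp only [Pi.one_apply, mul_one] at e1 e2
      simp only [e1, e2, sum_fin_succ_pi (n := n)]
      push_cast
      ring
    · simp only [Prod.snd_sum, Prod.snd_add]
      rw [Finset.sum_comm (t := (Finset.univ : Finset M)),
        Finset.sum_comm (t := (Finset.univ : Finset M))]
      simp only [sum_headY W _ fun x => ∑ i, C (x i), sum_tailZ W, sum_fin_succ_pi (n := n),
        Fin.sum_univ_succ, Fin.cons_zero, Fin.cons_succ, mul_add, Finset.sum_add_distrib]
      ring

end Block

/-! ### Mutual information of a prior and a kernel -/

section Kernel

variable {M O : Type*} [Fintype M] [Fintype O]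

/-- The mutual information, in bits, of the input and the output of the kernel `Γ` with the
input measure `π`. -/
def kernelInfo (π : M → ℝ) (Γ : M → O → ℝ) : ℝ :=
  ∑ m, ∑ o, π m * Γ m o * Real.logb 2 (π m * Γ m o / (π m * ∑ m', π m' * Γ m' o))

theorem kernelInfo_eq_ent {π : M → ℝ} {Γ : M → O → ℝ} (hπ : ∀ m, 0 ≤ π m)
    (hΓ : ∀ m o, 0 ≤ Γ m o) :
    kernelInfo π Γ = (ent (push Γ π) - ∑ m, π m * ent (Γ m)) / Real.log 2 := by
  have h : ∀ m o, π m * Γ m o * Real.logb 2 (π m * Γ m o / (π m * ∑ m', π m' * Γ m' o)) =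
      (- (π m * Real.negMulLog (Γ m o)) - π m * Γ m o * Real.log (push Γ π o)) / Real.log 2 := by
    intro m o
    rcases (hπ m).eq_or_lt with h0 | h0
    · simp [← h0]
    rcases (hΓ m o).eq_or_lt with h1 | h1
    · simp [← h1]
    have h2 : 0 < push Γ π o := (mul_pos h0 h1).trans_le
      (Finset.single_le_sum (f := fun m => π m * Γ m o) (fun m _ => mul_nonneg (hπ m) (hΓ m o))
        (Finset.mem_univ m))
    rw [mul_div_mul_left _ _ h0.ne', Real.logb, ← push, Real.log_div h1.ne' h2.ne', Real.negMulLog]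
    ring
  simp only [kernelInfo, h, ← Finset.sum_div, Finset.sum_sub_distrib, Finset.sum_neg_distrib,
    ← Finset.mul_sum]
  have h3 : ∑ m, ∑ o, π m * Γ m o * Real.log (push Γ π o) = - ent (push Γ π) := by
    rw [Finset.sum_comm, ent, ← Finset.sum_neg_distrib]
    refine Finset.sum_congr rfl fun o _ => ?_
    rw [← Finset.sum_mul, Real.negMulLog, neg_mul, neg_neg]
    rfl
  rw [h3]
  simp only [ent]
  ring

theorem kernelInfo_eq_log {π : M → ℝ} {Γ : M → O → ℝ} :
    kernelInfo π Γ = (∑ t : M × O, π t.1 * Γ t.1 t.2 *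
      Real.log (π t.1 * Γ t.1 t.2 / (π t.1 * push Γ π t.2))) / Real.log 2 := by
  simp only [kernelInfo, Fintype.sum_prod_type, Real.logb, Finset.sum_div, push, mul_div_assoc]

theorem push_pos {π : M → ℝ} {Γ : M → O → ℝ} (hπ : ∀ m, 0 ≤ π m)
    (hΓ : ∀ m o, 0 ≤ Γ m o) {m : M} {o : O} (h : 0 < π m * Γ m o) : 0 < push Γ π o :=
  h.trans_le (Finset.single_le_sum (f := fun m => π m * Γ m o)
    (fun m _ => mul_nonneg (hπ m) (hΓ m o)) (Finset.mem_univ m))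

theorem push_nonneg {π : M → ℝ} {Γ : M → O → ℝ} (hπ : ∀ m, 0 ≤ π m)
    (hΓ : ∀ m o, 0 ≤ Γ m o) (o : O) : 0 ≤ push Γ π o :=
  Finset.sum_nonneg fun m _ => mul_nonneg (hπ m) (hΓ m o)

/-- A variational lower bound: weighting the product of the marginals by `r` leaves mass at most
one, so Gibbs' inequality applies. It yields nonnegativity for `r = 1` and Fano's inequality for an
`r` that favours the decoded message. -/
theorem sum_mul_log_le_kernelInfo {π : M → ℝ} {Γ : M → O → ℝ} (hπ : ∀ m, 0 ≤ π m)
    (hπ1 : ∑ m, π m = 1) (hΓ : ∀ m o, 0 ≤ Γ m o) (hΓ1 : ∀ m, ∑ o, Γ m o = 1) {r : M → O → ℝ}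
    (hr : ∀ m o, 0 < r m o) (hs : ∀ o, ∑ m, π m * r m o ≤ 1) :
    (∑ m, ∑ o, π m * Γ m o * Real.log (r m o)) / Real.log 2 ≤ kernelInfo π Γ := by
  rw [kernelInfo_eq_log]
  refine div_le_div_of_nonneg_right ?_ (Real.log_nonneg one_le_two)
  rw [← Fintype.sum_prod_type (f := fun t : M × O => π t.1 * Γ t.1 t.2 * Real.log (r t.1 t.2))]
  refine sum_mul_log_le_divergence (r := fun t : M × O => r t.1 t.2)
    (fun t => mul_nonneg (hπ _) (hΓ _ _))
    (fun t => mul_nonneg (hπ _) (push_nonneg hπ hΓ _)) (fun t => hr _ _) (fun t ht => ?_) ?_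
  · exact mul_pos (lt_of_le_of_ne (hπ _) fun h => by simp [← h] at ht) (push_pos hπ hΓ ht)
  · simp only [Fintype.sum_prod_type, ← Finset.mul_sum, hΓ1, mul_one, hπ1]
    rw [Finset.sum_comm]
    calc ∑ o, ∑ m, π m * push Γ π o * r m o = ∑ o, push Γ π o * ∑ m, π m * r m o := by
          refine Finset.sum_congr rfl fun o _ => ?_
          rw [Finset.mul_sum]
          exact Finset.sum_congr rfl fun m _ => by ring
      _ ≤ ∑ o, push Γ π o := Finset.sum_le_sum fun o _ =>
          mul_le_of_le_one_right (push_nonneg hπ hΓ o) (hs o)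
      _ = 1 := by rw [sum_push hΓ1, hπ1]

theorem kernelInfo_nonneg {π : M → ℝ} {Γ : M → O → ℝ} (hπ : ∀ m, 0 ≤ π m)
    (hπ1 : ∑ m, π m = 1) (hΓ : ∀ m o, 0 ≤ Γ m o) (hΓ1 : ∀ m, ∑ o, Γ m o = 1) :
    0 ≤ kernelInfo π Γ := by
  have h := sum_mul_log_le_kernelInfo hπ hπ1 hΓ hΓ1 (r := fun _ _ => 1) (fun _ _ => one_pos)
    fun o => by simp [hπ1]
  simpa using h

/-- The mutual information is at most the average divergence from any reference law. -/
theorem kernelInfo_le {π : M → ℝ} {Γ : M → O → ℝ} (hπ : ∀ m, 0 ≤ π m)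
    (hπ1 : ∑ m, π m = 1) (hΓ : ∀ m o, 0 ≤ Γ m o) (hΓ1 : ∀ m, ∑ o, Γ m o = 1) {q : O → ℝ}
    (hq : ∀ o, 0 ≤ q o) (hq1 : ∑ o, q o ≤ 1) (hΓq : ∀ m o, 0 < Γ m o → 0 < q o) :
    kernelInfo π Γ ≤ (∑ m, π m * ∑ o, Γ m o * Real.log (Γ m o / q o)) / Real.log 2 := by
  rw [kernelInfo_eq_ent hπ hΓ]
  refine div_le_div_of_nonneg_right ?_ (Real.log_nonneg one_le_two)
  -- The average divergence from `q` exceeds the mutual information by the divergence of the output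
  -- law from `q`.
  have h := gibbs (push_nonneg hπ hΓ) hq (fun o ho => by
    obtain ⟨m, _, hm⟩ := Finset.exists_ne_zero_of_sum_ne_zero ho.ne'
    exact hΓq m o (lt_of_le_of_ne (hΓ m o) fun h => hm (by simp [← h])))
    (by rw [sum_push hΓ1, hπ1]; exact hq1)
  have h1 : ∀ o, push Γ π o * Real.log (push Γ π o / q o) =
      -Real.negMulLog (push Γ π o) - ∑ m, π m * (Γ m o * Real.log (q o)) := by
    intro o
    have h2 : ∑ m, π m * (Γ m o * Real.log (q o)) = push Γ π o * Real.log (q o) := by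
      rw [push, Finset.sum_mul]
      exact Finset.sum_congr rfl fun m _ => by ring
    rw [h2]
    rcases (push_nonneg hπ hΓ o).eq_or_lt with h0 | h0
    · simp [← h0]
    · obtain ⟨m, _, hm⟩ := Finset.exists_ne_zero_of_sum_ne_zero h0.ne'
      have h3 := hΓq m o (lt_of_le_of_ne (hΓ m o) fun h => hm (by simp [← h]))
      rw [Real.log_div h0.ne' h3.ne', Real.negMulLog]
      ring
  have h2 : ∀ m o, Γ m o * Real.log (Γ m o / q o) =
      -Real.negMulLog (Γ m o) - Γ m o * Real.log (q o) := by
    intro m o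
    rcases (hΓ m o).eq_or_lt with h0 | h0
    · simp [← h0]
    · rw [Real.log_div h0.ne' (hΓq m o h0).ne', Real.negMulLog]
      ring
  simp only [h1, Finset.sum_sub_distrib, Finset.sum_neg_distrib] at h
  simp only [h2, Finset.sum_sub_distrib, Finset.sum_neg_distrib, mul_sub, mul_neg]
  rw [Finset.sum_comm] at h
  simp only [← Finset.mul_sum] at h
  simp only [ent]
  linarith

end Kernel

/-! ### The converse -/

section Converse

variable {X Y Z : Type*} [Fintype X] [Fintype Y] [Fintype Z]
  {W : X → stdSimplex ℝ (Y × Z)} {C : X → ℝ} {b : ℝ} {n : ℕ} {R : ℝ}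

/-- The law of the main channel output for each message. -/
def mainOut (W : X → stdSimplex ℝ (Y × Z)) (c : Code X Y C b n R) (m : Msg n R) :
    (Fin n → Y) → ℝ := push (mainPow W) (c.enc m)

/-- The law of the eavesdropper's output for each message. -/
def eavesOut (W : X → stdSimplex ℝ (Y × Z)) (c : Code X Y C b n R) (m : Msg n R) :
    (Fin n → Z) → ℝ := push (eavesPow W) (c.enc m)

theorem enc_nonneg (c : Code X Y C b n R) (m : Msg n R) (x : Fin n → X) : 0 ≤ c.enc m x :=
  (c.enc m).2.1 x

theorem sum_enc (c : Code X Y C b n R) (m : Msg n R) : ∑ x, c.enc m x = 1 := (c.enc m).2.2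

theorem mainOut_nonneg (c : Code X Y C b n R) (m : Msg n R) (y : Fin n → Y) :
    0 ≤ mainOut W c m y := push_nonneg (enc_nonneg c m) (mainPow_nonneg W) y

theorem eavesOut_nonneg (c : Code X Y C b n R) (m : Msg n R) (z : Fin n → Z) :
    0 ≤ eavesOut W c m z := push_nonneg (enc_nonneg c m) (eavesPow_nonneg W) z

theorem sum_mainOut (c : Code X Y C b n R) (m : Msg n R) : ∑ y, mainOut W c m y = 1 := by
  rw [mainOut, sum_push (sum_mainPow W), sum_enc]

theorem sum_eavesOut (c : Code X Y C b n R) (m : Msg n R) : ∑ z, eavesOut W c m z = 1 := by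
  rw [eavesOut, sum_push (sum_eavesPow W), sum_enc]

theorem sum_channelPow (W : X → stdSimplex ℝ (Y × Z)) (x : Fin n → X) (z : Fin n → Z) :
    ∑ y, channelPow W x y z = eavesPow W x z := by
  simp only [channelPow, eavesPow, chanZ]
  exact sum_pi_prod fun i a => W (x i) (a, z i)

theorem errorProb_eq (c : Code X Y C b n R) (m : Msg n R) :
    errorProb W c m = ∑ y, if c.dec y ≠ m then mainOut W c m y else 0 := by
  simp only [errorProb, mainOut, push, Finset.mul_sum, mul_ite, mul_zero]
  rw [Finset.sum_comm]
  refine Finset.sum_congr rfl fun y _ => ?_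
  split_ifs <;> simp

theorem law_induced (c : Code X Y C b n R) (pM : Msg n R → ℝ) (m : Msg n R) (z : Fin n → Z) :
    law (induced W c pM) (fun ω => (ω.1, ω.2.2.2.1)) (m, z) = pM m * eavesOut W c m z := by
  classical
  simp only [law_eq, Fintype.sum_prod_type, induced, Prod.mk.injEq, ite_and]
  simp only [Finset.sum_ite_irrel, Finset.sum_const_zero, Finset.sum_ite_eq', Finset.mem_univ,
    if_true, mul_ite, mul_one, mul_zero]
  simp only [eavesOut, push, Finset.mul_sum, ← sum_channelPow, mul_assoc]

theorem leakage_eq (c : Code X Y C b n R) (pM : Msg n R → ℝ) :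
    leakage W c pM = kernelInfo pM (eavesOut W c) := by
  have h1 : ∀ m, law (induced W c pM) (fun ω => ω.1) m = pM m := by
    intro m
    rw [← sum_law_snd _ (fun ω => ω.1)
      (fun ω : Msg n R × (Fin n → X) × (Fin n → Y) × (Fin n → Z) × Msg n R => ω.2.2.2.1)]
    simp only [law_induced, ← Finset.mul_sum, sum_eavesOut, mul_one]
  have h2 : ∀ z, law (induced W c pM) (fun ω => ω.2.2.2.1) z =
      ∑ m, pM m * eavesOut W c m z := by
    intro z
    rw [← sum_law_fst _ (fun ω => ω.1)
      (fun ω : Msg n R × (Fin n → X) × (Fin n → Y) × (Fin n → Z) × Msg n R => ω.2.2.2.1)]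
    simp only [law_induced]
  simp only [leakage, mutualInfo, law_induced, h1, h2, kernelInfo]

theorem uniformMsg_nonneg (m : Msg n R) : 0 ≤ uniformMsg n R m := by
  unfold uniformMsg
  positivity

theorem one_le_rpow_two (n : ℕ) (hR : 0 ≤ R) : (1 : ℝ) ≤ 2 ^ ((n : ℝ) * R) :=
  Real.one_le_rpow one_le_two (mul_nonneg n.cast_nonneg hR)

theorem card_msg_pos (n : ℕ) (hR : 0 ≤ R) : 0 < Fintype.card (Msg n R) := by
  rw [Fintype.card_fin]
  exact Nat.floor_pos.2 (one_le_rpow_two n hR)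

theorem sum_uniformMsg (n : ℕ) (hR : 0 ≤ R) : ∑ m, uniformMsg n R m = 1 := by
  have := card_msg_pos n hR
  simp only [uniformMsg, Finset.sum_const, Finset.card_univ, nsmul_eq_mul]
  field_simp

theorem leakage_nonneg (c : Code X Y C b n R) {pM : Msg n R → ℝ} (hp : ∀ m, 0 ≤ pM m)
    (hp1 : ∑ m, pM m = 1) : 0 ≤ leakage W c pM := by
  rw [leakage_eq]
  exact kernelInfo_nonneg hp hp1 (eavesOut_nonneg c) (sum_eavesOut c)

theorem errorProb_le_maxErrorProb (c : Code X Y C b n R) (m : Msg n R) :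
    errorProb W c m ≤ maxErrorProb W c := le_ciSup (Set.finite_range _).bddAbove m

/-- Fano's inequality for a uniform message. -/
theorem fano (c : Code X Y C b n R) (hR : 0 ≤ R) {ε : ℝ} (hε : maxErrorProb W c ≤ ε) :
    (1 - ε) * Real.logb 2 (Fintype.card (Msg n R)) - 1 ≤
      kernelInfo (uniformMsg n R) (mainOut W c) := by
  have hN := card_msg_pos n hR
  set N := Fintype.card (Msg n R)
  have hN1 : (1 : ℝ) ≤ N := by exact_mod_cast hN
  have hN0 : (0 : ℝ) < N := by linarith
  have h := sum_mul_log_le_kernelInfo uniformMsg_nonneg (sum_uniformMsg n hR)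
    (mainOut_nonneg (W := W) c) (sum_mainOut c)
    -- Under the uniform prior this weight averages to 1/2 + (N - 1)/(2N) = 1 - 1/(2N) for each
    -- output, hence to at most one.
    (r := fun m y => if c.dec y ≠ m then (1 / 2 : ℝ) else N / 2)
    (fun m y => by split_ifs <;> positivity) fun y => by
      have e : ∀ m, uniformMsg n R m * (if c.dec y ≠ m then (1 / 2 : ℝ) else N / 2) =
          uniformMsg n R m * (1 / 2) +
            if c.dec y = m then (1 / (N : ℝ)) * (((N : ℝ) - 1) / 2) else 0 := by
        intro m
        by_cases hm : c.dec y = m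
        · simp only [hm, ne_eq, not_true_eq_false, if_false, if_true, uniformMsg]
          change 1 / (N : ℝ) * _ = 1 / (N : ℝ) * _ + _
          ring
        · simp [hm]
      rw [Finset.sum_congr rfl fun m _ => e m, Finset.sum_add_distrib, ← Finset.sum_mul,
        sum_uniformMsg n hR, Finset.sum_ite_eq]
      simp only [Finset.mem_univ, if_true]
      have : 1 / (N : ℝ) * ((N - 1) / 2) = 1 / 2 - 1 / (2 * N) := by field_simp
      have : 0 < 1 / (2 * (N : ℝ)) := by positivity
      linarith
  refine le_trans ?_ h
  have hlog2 : 0 < Real.log 2 := Real.log_pos one_lt_two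
  have hlogN : 0 ≤ Real.log N := Real.log_nonneg hN1
  have e : ∀ m y, uniformMsg n R m * mainOut W c m y *
      Real.log (if c.dec y ≠ m then (1 / 2 : ℝ) else N / 2) = uniformMsg n R m *
      (mainOut W c m y * (Real.log N - Real.log 2) -
        (if c.dec y ≠ m then mainOut W c m y else 0) * Real.log N) := by
    intro m y
    split_ifs
    · rw [one_div, Real.log_inv]
      ring
    · rw [Real.log_div hN0.ne' two_ne_zero]
      ring
  simp only [e, ← Finset.mul_sum, Finset.sum_sub_distrib, ← Finset.sum_mul, sum_mainOut,
    ← errorProb_eq]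
  rw [le_div_iff₀ hlog2]
  have h2 : ∑ m, uniformMsg n R m * (1 * (Real.log N - Real.log 2) - ε * Real.log N) ≤
      ∑ m, uniformMsg n R m * (1 * (Real.log N - Real.log 2) - errorProb W c m * Real.log N) := by
    refine Finset.sum_le_sum fun m _ => mul_le_mul_of_nonneg_left ?_ (uniformMsg_nonneg m)
    have := mul_le_mul_of_nonneg_right ((errorProb_le_maxErrorProb c m).trans hε) hlogN
    linarith
  rw [← Finset.sum_mul, sum_uniformMsg n hR] at h2
  refine le_trans (le_of_eq ?_) h2
  rw [Real.logb, sub_mul, mul_assoc, div_mul_cancel₀ _ hlog2.ne']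
  ring

variable [Nonempty X]

/-- The advantage of the receiver over the eavesdropper is bounded by the single-letter
expression. -/
theorem kernelInfo_sub_le (c : Code X Y C b n R) (hb : ∃ x, C x ≤ b) (hn : 0 < n)
    {pM : Msg n R → ℝ} (hp : ∀ m, 0 ≤ pM m) (hp1 : ∑ m, pM m = 1) :
    kernelInfo pM (mainOut W c) - kernelInfo pM (eavesOut W c) ≤ n * singleLetter W C b := by
  have h := block_split_mem_regionCone W C n (p := fun m => pM m • (c.enc m : (Fin n → X) → ℝ))
    fun m x => mul_nonneg (hp m) (enc_nonneg c m x)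
  have hn' : (0 : ℝ) < n := by exact_mod_cast hn
  have hmass : ∑ m, ∑ x, (pM m • (c.enc m : (Fin n → X) → ℝ)) x = 1 := by
    simp only [Pi.smul_apply, smul_eq_mul, ← Finset.mul_sum, sum_enc, mul_one, hp1]
  have hcost : (∑ m, ∑ x, (pM m • (c.enc m : (Fin n → X) → ℝ)) x * ∑ i, C (x i)) / n ≤ b := by
    have h1 : ∀ m, pM m * ∑ x, c.enc m x * blockCost C x ≤ pM m * b := fun m =>
      mul_le_mul_of_nonneg_left (c.cost_le m) (hp m)
    have h2 := Finset.sum_le_sum fun m (_ : m ∈ Finset.univ) => h1 m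
    rw [← Finset.sum_mul, hp1, one_mul] at h2
    refine le_trans (le_of_eq ?_) h2
    simp only [Finset.sum_div]
    refine Finset.sum_congr rfl fun m _ => ?_
    rw [Finset.mul_sum]
    refine Finset.sum_congr rfl fun x _ => ?_
    simp only [Pi.smul_apply, smul_eq_mul, blockCost]
    ring
  rw [hmass, mul_one] at h
  have h1 := le_singleLetter_of_mem_region hb (mem_region_of_mem_regionCone hn' h) hcost
  simp only at h1
  rw [div_le_iff₀ hn'] at h1
  rw [mul_comm (n : ℝ) (singleLetter W C b)]
  refine le_trans (le_of_eq ?_) h1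
  have e1 : push (mainOut W c) pM =
      push (mainPow W) (∑ m, pM m • (c.enc m : (Fin n → X) → ℝ)) := by
    funext y
    simp only [push_sum, push_smul, Finset.sum_apply, Pi.smul_apply, smul_eq_mul]
    rfl
  have e2 : push (eavesOut W c) pM =
      push (eavesPow W) (∑ m, pM m • (c.enc m : (Fin n → X) → ℝ)) := by
    funext y
    simp only [push_sum, push_smul, Finset.sum_apply, Pi.smul_apply, smul_eq_mul]
    rfl
  rw [kernelInfo_eq_ent hp (mainOut_nonneg c), kernelInfo_eq_ent hp (eavesOut_nonneg c), e1, e2]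
  simp only [blockGap_smul]
  simp only [blockGap, mainOut, eavesOut, mul_div_assoc', ← Finset.sum_div, mul_sub,
    Finset.sum_sub_distrib]
  ring

/-- Fano's inequality and the single-letter bound give (1 - ε) R - 2/n ≤ S + ε. Then n tends to
infinity and ε to zero. -/
theorem weakRates_le (hb : ∃ x, C x ≤ b) {R : ℝ} (hR : R ∈ weakRates W C b) :
    R ≤ singleLetter W C b := by
  obtain ⟨hR0, hR⟩ := hR
  set S := singleLetter W C b
  have key : ∀ ε : ℝ, 0 < ε → ε < 1 → (1 - ε) * R ≤ S + ε := by
    intro ε hε hε1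
    have h : ∀ᶠ n : ℕ in atTop, (1 - ε) * R - 2 / n ≤ S + ε := by
      filter_upwards [hR ε hε, eventually_gt_atTop 0] with n ⟨c, hc⟩ hn
      have hn' : (0 : ℝ) < n := by exact_mod_cast hn
      have h1 := fano c hR0 ((le_max_left _ _).trans hc)
      have h2 := (le_max_right _ _).trans hc
      have h3 := kernelInfo_sub_le (W := W) c hb hn uniformMsg_nonneg (sum_uniformMsg n hR0)
      rw [weakMetric, leakage_eq, one_div, inv_mul_le_iff₀ hn'] at h2
      -- Taking the floor costs at most one bit, as ⌊t⌋ ≥ t/2 for t ≥ 1. With the bit lost in Fano's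
      -- inequality this makes the term 2/n.
      have h4 : (n : ℝ) * R - 1 ≤ Real.logb 2 (Fintype.card (Msg n R)) := by
        have hN := card_msg_pos n hR0
        have hN1 : (1 : ℝ) ≤ Fintype.card (Msg n R) := by exact_mod_cast hN
        have h5 := Nat.lt_floor_add_one ((2 : ℝ) ^ ((n : ℝ) * R))
        rw [Fintype.card_fin] at hN1 ⊢
        rw [Real.le_logb_iff_rpow_le one_lt_two (by linarith), Real.rpow_sub two_pos,
          Real.rpow_one]
        linarith
      have h5 := mul_le_mul_of_nonneg_left h4 (sub_nonneg.2 hε1.le)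
      have h6 : (n : ℝ) * ((1 - ε) * R - 2 / n) ≤ n * (S + ε) := by
        rw [mul_sub, mul_div_cancel₀ _ hn'.ne']
        linarith
      exact le_of_mul_le_mul_left h6 hn'
    have hlim : Tendsto (fun n : ℕ => (1 - ε) * R - 2 / (n : ℝ)) atTop (nhds ((1 - ε) * R - 0)) :=
      tendsto_const_nhds.sub (tendsto_const_nhds.div_atTop tendsto_natCast_atTop_atTop)
    simpa using le_of_tendsto hlim h
  have hlim : Tendsto (fun ε : ℝ => S + ε - (1 - ε) * R) (nhdsWithin 0 (Set.Ioi 0))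
      (nhds (S + 0 - (1 - 0) * R)) := by
    refine Tendsto.mono_left (Continuous.tendsto ?_ 0) nhdsWithin_le_nhds
    fun_prop
  have h0 : 0 ≤ S + 0 - (1 - 0) * R := by
    refine ge_of_tendsto hlim ?_
    filter_upwards [Ioo_mem_nhdsGT (zero_lt_one' ℝ)] with ε hε
    exact sub_nonneg.2 (key ε hε.1 hε.2)
  linarith

theorem strongRates_subset : strongRates W C b ⊆ weakRates W C b := by
  rintro R ⟨hR0, hR⟩
  refine ⟨hR0, fun ε hε => ?_⟩
  filter_upwards [hR ε hε, eventually_gt_atTop 0] with n ⟨c, hc⟩ hn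
  refine ⟨c, max_le ((le_max_left _ _).trans hc) ?_⟩
  have h1 := (le_max_right _ _).trans hc
  have h0 := leakage_nonneg (W := W) c uniformMsg_nonneg (sum_uniformMsg n hR0)
  have hn' : (1 : ℝ) ≤ n := by exact_mod_cast hn
  refine le_trans ?_ h1
  rw [weakMetric, strongMetric, one_div]
  exact mul_le_of_le_one_left h0 (inv_le_one_of_one_le₀ hn')

/-- An unbounded real supremum defaults to zero, so the semantic metric dominates each leakage only
once boundedness is known. The divergences from the uniform law on output sequences bound it
uniformly in the prior. -/
theorem bddAbove_leakage (c : Code X Y C b n R) :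
    BddAbove (Set.range fun pM : stdSimplex ℝ (Msg n R) => leakage W c pM) := by
  have hZ : Nonempty Z := by
    obtain ⟨x⟩ := ‹Nonempty X›
    by_contra h
    rw [not_nonempty_iff] at h
    simpa using sum_chanZ W x
  set q : (Fin n → Z) → ℝ := fun _ => 1 / Fintype.card (Fin n → Z) with hq
  have hqpos : ∀ z, 0 < q z := fun z => by
    have : 0 < Fintype.card (Fin n → Z) := Fintype.card_pos
    simp only [hq]
    positivity
  have hq1 : ∑ z, q z ≤ 1 := by
    simp [hq]
  refine ⟨(∑ m, |∑ z, eavesOut W c m z * Real.log (eavesOut W c m z / q z)|) / Real.log 2, ?_⟩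
  rintro _ ⟨pM, rfl⟩
  simp only [leakage_eq]
  refine (kernelInfo_le pM.2.1 pM.2.2 (eavesOut_nonneg c) (sum_eavesOut c)
    (fun z => (hqpos z).le) hq1 fun m z _ => hqpos z).trans ?_
  refine div_le_div_of_nonneg_right (Finset.sum_le_sum fun m _ => ?_)
    (Real.log_nonneg one_le_two)
  have h1 : pM m ≤ 1 := by
    rw [← pM.2.2]
    exact Finset.single_le_sum (f := fun m => pM m) (fun m _ => pM.2.1 m) (Finset.mem_univ m)
  calc _ ≤ pM m * |∑ z, eavesOut W c m z * Real.log (eavesOut W c m z / q z)| :=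
        mul_le_mul_of_nonneg_left (le_abs_self _) (pM.2.1 m)
    _ ≤ _ := mul_le_of_le_one_left (abs_nonneg _) h1

theorem semRates_subset : semRates W C b ⊆ strongRates W C b := by
  rintro R ⟨hR0, hR⟩
  refine ⟨hR0, fun ε hε => ?_⟩
  filter_upwards [hR ε hε] with n ⟨c, hc⟩
  refine ⟨c, max_le ((le_max_left _ _).trans hc) (le_trans ?_ ((le_max_right _ _).trans hc))⟩
  exact le_ciSup (bddAbove_leakage c)
    ⟨uniformMsg n R, uniformMsg_nonneg, sum_uniformMsg n hR0⟩

end Converse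

/-! ### Random codebooks -/

section RandomCodebook

variable {V Y Z ι : Type*} [Fintype V] [Fintype Y] [Fintype Z] [Fintype ι]

/-- Two distinct codewords are independent: the integrand is a product over all indices with trivial
factors except at `i` and `j`. -/
theorem sum_codebook_mul_mul [DecidableEq ι] {κ : V → ℝ} (hκ : ∑ v, κ v = 1) {i j : ι}
    (hij : i ≠ j) (f g : V → ℝ) :
    ∑ c : ι → V, (∏ k, κ (c k)) * (f (c i) * g (c j)) = (∑ v, κ v * f v) * ∑ v, κ v * g v := by
  let h : ι → V → ℝ := fun k v => if k = i then f v else if k = j then g v else 1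
  have h1 : ∀ c : ι → V, ∏ k, h k (c k) = f (c i) * g (c j) := by
    intro c
    rw [Fintype.prod_eq_mul i j hij]
    · simp [h, hij.symm]
    · rintro k ⟨hk, hk'⟩
      simp [h, hk, hk']
  have h2 : ∏ k, ∑ v, κ v * h k v = (∑ v, κ v * f v) * ∑ v, κ v * g v := by
    rw [Fintype.prod_eq_mul i j hij]
    · simp [h, hij.symm]
    · rintro k ⟨hk, hk'⟩
      simp [h, hk, hk', hκ]
  rw [← h2, Finset.prod_univ_sum, Fintype.piFinset_univ]
  exact Finset.sum_congr rfl fun c _ => by rw [← h1, ← Finset.prod_mul_distrib]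

theorem sum_codebook_mul [DecidableEq ι] {κ : V → ℝ} (hκ : ∑ v, κ v = 1) (i : ι) (f : V → ℝ) :
    ∑ c : ι → V, (∏ k, κ (c k)) * f (c i) = ∑ v, κ v * f v := by
  let h : ι → V → ℝ := fun k v => if k = i then f v else 1
  have h1 : ∀ c : ι → V, ∏ k, h k (c k) = f (c i) := by
    intro c
    rw [Fintype.prod_eq_single i]
    · simp [h]
    · intro k hk
      simp [h, hk]
  have h2 : ∏ k, ∑ v, κ v * h k v = ∑ v, κ v * f v := by
    rw [Fintype.prod_eq_single i]
    · simp [h]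
    · intro k hk
      simp [h, hk, hκ]
  rw [← h2, Finset.prod_univ_sum, Fintype.piFinset_univ]
  exact Finset.sum_congr rfl fun c _ => by rw [← h1, ← Finset.prod_mul_distrib]

theorem sum_codebook [DecidableEq ι] {κ : V → ℝ} (hκ : ∑ v, κ v = 1) :
    ∑ c : ι → V, ∏ k, κ (c k) = 1 := by
  have h := Finset.prod_univ_sum (fun _ : ι => (Finset.univ : Finset V)) fun _ => κ
  rw [Fintype.piFinset_univ] at h
  rw [← h]
  simp [hκ]

/-- The first-moment method. Positive weight of the chosen point matters: for codebooks it keeps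
every codeword in the support of its law, so the reference law is positive wherever an output is
possible. -/
theorem exists_le_of_weighted_sum_le {α : Type*} [Fintype α] {w F : α → ℝ} (hw : ∀ a, 0 ≤ w a)
    (hw1 : ∑ a, w a = 1) {τ : ℝ} (h : ∑ a, w a * F a ≤ τ) : ∃ a, 0 < w a ∧ F a ≤ τ := by
  by_contra! hcon
  have h1 : ∀ a, w a * τ ≤ w a * F a := fun a => by
    rcases (hw a).eq_or_lt with h0 | h0
    · simp [← h0]
    · exact mul_le_mul_of_nonneg_left (hcon a h0).le h0.le
  obtain ⟨a, _, ha⟩ := Finset.exists_ne_zero_of_sum_ne_zero (hw1 ▸ one_ne_zero : ∑ a, w a ≠ 0)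
  have ha' : 0 < w a := lt_of_le_of_ne (hw a) ha.symm
  have h2 : ∑ a, w a * τ < ∑ a, w a * F a := Finset.sum_lt_sum (fun a _ => h1 a)
    ⟨a, Finset.mem_univ a, mul_lt_mul_of_pos_left (hcon a ha') ha'⟩
  rw [← Finset.sum_mul, hw1, one_mul] at h2
  linarith

/-- The soft-covering bound for one output symbol. -/
theorem soft_covering_term [DecidableEq ι] {κ : V → ℝ} (hκ0 : ∀ v, 0 ≤ κ v) (hκ : ∑ v, κ v = 1)
    {β : V → ℝ} (hβ : ∀ v, 0 ≤ β v) (i : ι) (s : Finset ι) (hi : i ∈ s) {q : ℝ}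
    (hq : q = ∑ v, κ v * β v) :
    ∑ c : ι → V, (∏ k, κ (c k)) * (β (c i) *
      Real.log ((1 / (s.card : ℝ)) * (∑ j ∈ s, β (c j)) / q)) ≤
      ∑ v, κ v * (β v * Real.log (1 + β v / (s.card * q))) := by
  have hq0 : 0 ≤ q := hq ▸ Finset.sum_nonneg fun v _ => mul_nonneg (hκ0 v) (hβ v)
  rcases hq0.eq_or_lt with h0 | h0
  · simp [← h0]
  have hL : (0 : ℝ) < s.card := by exact_mod_cast Finset.card_pos.2 ⟨i, hi⟩
  set L : ℝ := (s.card : ℝ)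
  have hLq : 0 < L * q := mul_pos hL h0
  -- Jensen's inequality given the codeword `i`, made explicit: log is replaced by its tangent at 1
  -- + x/(Lq), x the value of `β` at that codeword. The tangent has slope 1/(1 + x/(Lq)), and `g` is
  -- x times this slope.
  let g : V → ℝ := fun v => β v / (1 + β v / (L * q))
  have hden : ∀ v, 0 < 1 + β v / (L * q) := fun v => by
    have := hβ v
    positivity
  have hg : ∀ v, 0 ≤ g v := fun v => div_nonneg (hβ v) (hden v).le
  have hpt : ∀ c : ι → V, β (c i) * Real.log ((1 / L) * (∑ j ∈ s, β (c j)) / q) ≤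
      β (c i) * Real.log (1 + β (c i) / (L * q)) - g (c i) +
        ∑ j ∈ s.erase i, g (c i) * (β (c j) / (L * q)) := by
    intro c
    rw [← Finset.mul_sum, ← Finset.sum_div]
    set S := ∑ j ∈ s.erase i, β (c j)
    have hS : 0 ≤ S := Finset.sum_nonneg fun j _ => hβ _
    have hsum : ∑ j ∈ s, β (c j) = β (c i) + S := (Finset.add_sum_erase s _ hi).symm
    rcases (hβ (c i)).eq_or_lt with hb | hb
    · simp [g, ← hb]
    set x := β (c i)
    have hd := hden (c i)
    change 0 < 1 + x / (L * q) at hd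
    have ht : (1 / L) * (∑ j ∈ s, β (c j)) / q = (x + S) / (L * q) := by
      rw [hsum]
      field_simp
    have htpos : 0 < (x + S) / (L * q) := by positivity
    have h1 := Real.log_le_sub_one_of_pos (div_pos htpos hd)
    rw [Real.log_div htpos.ne' hd.ne'] at h1
    have h2 : (x + S) / (L * q) / (1 + x / (L * q)) - 1 =
        (S / (L * q) - 1) / (1 + x / (L * q)) := by
      rw [div_sub_one hd.ne']
      congr 1
      rw [add_div]
      ring
    have h3 : g (c i) = x * (1 / (1 + x / (L * q))) := by
      simp only [g]
      ring
    rw [ht, h3]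
    have h4 : Real.log ((x + S) / (L * q)) ≤ Real.log (1 + x / (L * q)) +
        (S / (L * q) - 1) / (1 + x / (L * q)) := by linarith
    refine (mul_le_mul_of_nonneg_left h4 hb.le).trans (le_of_eq ?_)
    ring
  have hE : ∑ c : ι → V, (∏ k, κ (c k)) * (β (c i) * Real.log (1 + β (c i) / (L * q)) - g (c i) +
      ∑ j ∈ s.erase i, g (c i) * (β (c j) / (L * q))) =
      ∑ v, κ v * (β v * Real.log (1 + β v / (L * q))) - (∑ v, κ v * g v) +
      ∑ j ∈ s.erase i, (∑ v, κ v * g v) * (1 / L) := by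
    simp only [mul_add, mul_sub, Finset.sum_add_distrib, Finset.sum_sub_distrib, Finset.mul_sum]
    rw [sum_codebook_mul hκ i fun v => β v * Real.log (1 + β v / (L * q)),
      sum_codebook_mul hκ i g, Finset.sum_comm]
    congr 1
    refine Finset.sum_congr rfl fun j hj => ?_
    have hji : i ≠ j := (Finset.ne_of_mem_erase hj).symm
    rw [sum_codebook_mul_mul hκ hji g fun v => β v / (L * q)]
    congr 1
    simp only [mul_div_assoc', ← Finset.sum_div, ← hq]
    field_simp
  refine (Finset.sum_le_sum fun c _ => mul_le_mul_of_nonneg_left (hpt c)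
    (Finset.prod_nonneg fun k _ => hκ0 _)).trans (hE.le.trans ?_)
  -- The other L - 1 codewords contribute 1 - 1/L times the mean of `g`, less than the full mean
  -- that is subtracted.
  rw [Finset.sum_const, Finset.card_erase_of_mem hi, nsmul_eq_mul,
    Nat.cast_sub (Finset.card_pos.2 ⟨i, hi⟩)]
  have hg0 : 0 ≤ ∑ v, κ v * g v := Finset.sum_nonneg fun v _ => mul_nonneg (hκ0 v) (hg v)
  have : ((L - (1 : ℕ)) * ((∑ v, κ v * g v) * (1 / L))) =
      (∑ v, κ v * g v) - (∑ v, κ v * g v) * (1 / L) := by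
    push_cast
    field_simp
  rw [this]
  have : 0 ≤ (∑ v, κ v * g v) * (1 / L) := by positivity
  linarith

open Classical in
/-- The decoder that looks for a message with a codeword that is typical with the output. -/
def thresholdDec {M L : ℕ} (hM : 0 < M) (J : V → Y → Prop) (c : Fin M × Fin L → V) (y : Y) :
    Fin M :=
  if h : ∃ m, ∃ l, J (c (m, l)) y then h.choose else ⟨0, hM⟩

open Classical in
-- A union bound: an error requires that the sent codeword fails the test or that some codeword of
-- another message passes it. When several messages pass, the choice among them is irrelevant.
theorem thresholdDec_ne_le {M L : ℕ} (hM : 0 < M) (J : V → Y → Prop) (c : Fin M × Fin L → V)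
    (y : Y) (m : Fin M) (l : Fin L) :
    (if thresholdDec hM J c y ≠ m then (1 : ℝ) else 0) ≤ (if J (c (m, l)) y then 0 else 1) +
      ∑ i ∈ Finset.univ.filter fun i : Fin M × Fin L => i.1 ≠ m,
        if J (c i) y then (1 : ℝ) else 0 := by
  have h0 : ∀ i : Fin M × Fin L, (0 : ℝ) ≤ if J (c i) y then (1 : ℝ) else 0 := fun i => by
    split_ifs <;> norm_num
  have hs : (0 : ℝ) ≤ ∑ i ∈ Finset.univ.filter fun i : Fin M × Fin L => i.1 ≠ m,
      if J (c i) y then (1 : ℝ) else 0 := Finset.sum_nonneg fun i _ => h0 i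
  by_cases h1 : thresholdDec hM J c y ≠ m
  · rw [if_pos h1]
    by_cases h2 : J (c (m, l)) y
    · rw [if_pos h2, zero_add]
      have hex : ∃ m, ∃ l, J (c (m, l)) y := ⟨m, l, h2⟩
      obtain ⟨l', hl'⟩ := hex.choose_spec
      have h3 : thresholdDec hM J c y = hex.choose := dif_pos hex
      rw [h3] at h1
      have := Finset.single_le_sum (f := fun i => if J (c i) y then (1 : ℝ) else 0)
        (fun i _ => h0 i) (show (hex.choose, l') ∈ Finset.univ.filter
          fun i : Fin M × Fin L => i.1 ≠ m from Finset.mem_filter.2 ⟨Finset.mem_univ _, h1⟩)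
      simpa only [hl', if_true] using this
    · rw [if_neg h2]
      linarith
  · rw [if_neg h1]
    split_ifs <;> linarith

open Classical in
/-- The threshold-decoding bound. -/
theorem threshold_error {M L : ℕ} (hM : 0 < M) {κ : V → ℝ} (hκ0 : ∀ v, 0 ≤ κ v)
    (hκ : ∑ v, κ v = 1) {A : V → Y → ℝ} (hA0 : ∀ v y, 0 ≤ A v y) (hA : ∀ v, ∑ y, A v y = 1)
    {T : ℝ} (hT : 0 < T) (m : Fin M) (l : Fin L) :
    ∑ c : Fin M × Fin L → V, (∏ k, κ (c k)) * ∑ y, A (c (m, l)) y *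
      (if thresholdDec hM (fun v y => T * push A κ y ≤ A v y) c y ≠ m then 1 else 0) ≤
      ∑ v, κ v * (∑ y, if T * push A κ y ≤ A v y then 0 else A v y) + M * L / T := by
  set J : V → Y → Prop := fun v y => T * push A κ y ≤ A v y with hJ
  set s := Finset.univ.filter fun i : Fin M × Fin L => i.1 ≠ m
  have hpt : ∀ c : Fin M × Fin L → V, ∑ y, A (c (m, l)) y *
      (if thresholdDec hM J c y ≠ m then (1 : ℝ) else 0) ≤
      (∑ y, if J (c (m, l)) y then 0 else A (c (m, l)) y) +
        ∑ i ∈ s, ∑ y, A (c (m, l)) y * if J (c i) y then (1 : ℝ) else 0 := by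
    intro c
    rw [Finset.sum_comm, ← Finset.sum_add_distrib]
    refine Finset.sum_le_sum fun y _ => ?_
    refine (mul_le_mul_of_nonneg_left (thresholdDec_ne_le hM J c y m l) (hA0 _ _)).trans ?_
    rw [mul_add, ← Finset.mul_sum, mul_ite, mul_zero, mul_one]
  refine (Finset.sum_le_sum fun c _ => mul_le_mul_of_nonneg_left (hpt c)
    (Finset.prod_nonneg fun k _ => hκ0 _)).trans ?_
  simp only [mul_add, Finset.sum_add_distrib]
  refine add_le_add (le_of_eq ?_) ?_
  · exact sum_codebook_mul hκ (m, l) fun v => ∑ y, if J v y then 0 else A v y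
  · simp only [Finset.mul_sum]
    rw [Finset.sum_comm]
    have hterm : ∀ i ∈ s, ∑ c : Fin M × Fin L → V, ∑ y, (∏ k, κ (c k)) *
        (A (c (m, l)) y * if J (c i) y then (1 : ℝ) else 0) ≤ 1 / T := by
      intro i hi
      have hne : (m, l) ≠ i := fun h => (Finset.mem_filter.1 hi).2 (by rw [← h])
      rw [Finset.sum_comm]
      calc ∑ y, ∑ c : Fin M × Fin L → V, (∏ k, κ (c k)) *
            (A (c (m, l)) y * if J (c i) y then (1 : ℝ) else 0)
          = ∑ y, push A κ y * ∑ v, κ v * if J v y then (1 : ℝ) else 0 := by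
            refine Finset.sum_congr rfl fun y _ => ?_
            exact sum_codebook_mul_mul hκ hne (fun v => A v y)
              fun v => if J v y then (1 : ℝ) else 0
        _ ≤ ∑ y, push A κ y * (1 / T) := by
            refine Finset.sum_le_sum fun y _ => ?_
            -- A change of measure: where the test holds, the output law is at most `A v y / T`, so
            -- an independent codeword passes with probability at most 1/T.
            have h1 : ∀ v, push A κ y * (κ v * if J v y then (1 : ℝ) else 0) ≤
                κ v * A v y * (1 / T) := by
              intro v
              by_cases h : J v y
              · rw [if_pos h, mul_one, mul_comm (push A κ y), mul_assoc]
                refine mul_le_mul_of_nonneg_left ?_ (hκ0 v)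
                rw [mul_one_div, le_div_iff₀ hT, mul_comm]
                exact h
              · rw [if_neg h, mul_zero, mul_zero]
                have := mul_nonneg (hκ0 v) (hA0 v y)
                positivity
            rw [Finset.mul_sum]
            refine (Finset.sum_le_sum fun v _ => h1 v).trans (le_of_eq ?_)
            rw [← Finset.sum_mul]
            rfl
        _ = 1 / T := by rw [← Finset.sum_mul, sum_push hA, hκ, one_mul]
    refine (Finset.sum_le_sum hterm).trans ?_
    rw [Finset.sum_const, nsmul_eq_mul, mul_one_div]
    refine div_le_div_of_nonneg_right ?_ hT.le
    have h1 := Finset.card_filter_le (Finset.univ : Finset (Fin M × Fin L)) fun i => i.1 ≠ m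
    rw [Finset.card_univ, Fintype.card_prod, Fintype.card_fin, Fintype.card_fin] at h1
    exact_mod_cast h1

end RandomCodebook

-- One-shot wiretap codes: soft covering and expurgation

section OneShot

variable {V Y Z : Type*} [Fintype V] [Fintype Y] [Fintype Z]

/-- The output law for a message whose codewords `c l` are used with equal probability. -/
def mixOut {O : Type*} {L : ℕ} (B : V → O → ℝ) (c : Fin L → V) (z : O) : ℝ :=
  (1 / (L : ℝ)) * ∑ l, B (c l) z

theorem mixOut_nonneg {O : Type*} {L : ℕ} {B : V → O → ℝ} (hB : ∀ v z, 0 ≤ B v z)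
    (c : Fin L → V) (z : O) : 0 ≤ mixOut B c z :=
  mul_nonneg (by positivity) (Finset.sum_nonneg fun _ _ => hB _ _)

theorem sum_mixOut {L : ℕ} (hL : 0 < L) {B : V → Z → ℝ} (hB1 : ∀ v, ∑ z, B v z = 1)
    (c : Fin L → V) : ∑ z, mixOut B c z = 1 := by
  have : (L : ℝ) ≠ 0 := by exact_mod_cast hL.ne'
  simp only [mixOut, ← Finset.mul_sum]
  rw [Finset.sum_comm]
  simp only [hB1, Finset.sum_const, Finset.card_univ, Fintype.card_fin, nsmul_eq_mul]
  field_simp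

theorem push_pos_of_mixOut_pos {L : ℕ} {κ : V → ℝ} (hκ0 : ∀ v, 0 ≤ κ v) {B : V → Z → ℝ}
    (hB : ∀ v z, 0 ≤ B v z) {c : Fin L → V} (hc : ∀ l, 0 < κ (c l)) {z : Z}
    (h : 0 < mixOut B c z) : 0 < push B κ z := by
  obtain ⟨l, _, hl⟩ := Finset.exists_ne_zero_of_sum_ne_zero (right_ne_zero_of_mul h.ne')
  exact push_pos hκ0 hB (mul_pos (hc l) (lt_of_le_of_ne (hB _ _) hl.symm))

/-- The expected divergence of the eavesdropper's output law from the reference law. -/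
theorem soft_covering {M L : ℕ} (hL : 0 < L) {κ : V → ℝ} (hκ0 : ∀ v, 0 ≤ κ v)
    (hκ : ∑ v, κ v = 1) {B : V → Z → ℝ} (hB : ∀ v z, 0 ≤ B v z) (m : Fin M) :
    ∑ c : Fin M × Fin L → V, (∏ k, κ (c k)) * ∑ z, mixOut B (fun l => c (m, l)) z *
      Real.log (mixOut B (fun l => c (m, l)) z / push B κ z) ≤
      ∑ v, κ v * ∑ z, B v z * Real.log (1 + B v z / (L * push B κ z)) := by
  have hL' : (0 : ℝ) < L := by exact_mod_cast hL
  have hterm : ∀ z l, ∑ c : Fin M × Fin L → V, (∏ k, κ (c k)) * (B (c (m, l)) z *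
      Real.log (mixOut B (fun l => c (m, l)) z / push B κ z)) ≤
      ∑ v, κ v * (B v z * Real.log (1 + B v z / (L * push B κ z))) := by
    intro z l
    have h := soft_covering_term hκ0 hκ (fun v => hB v z) (m, l)
      (({m} : Finset (Fin M)) ×ˢ (Finset.univ : Finset (Fin L))) (by simp)
      (q := push B κ z) rfl
    simp only [Finset.sum_product, Finset.sum_singleton, Finset.card_product,
      Finset.card_singleton, one_mul, Finset.card_univ, Fintype.card_fin] at h
    exact h
  have e1 : ∑ c : Fin M × Fin L → V, (∏ k, κ (c k)) * ∑ z, mixOut B (fun l => c (m, l)) z *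
      Real.log (mixOut B (fun l => c (m, l)) z / push B κ z) =
      ∑ z, (1 / (L : ℝ)) * ∑ l, ∑ c : Fin M × Fin L → V, (∏ k, κ (c k)) * (B (c (m, l)) z *
      Real.log (mixOut B (fun l => c (m, l)) z / push B κ z)) := by
    simp only [Finset.mul_sum]
    rw [Finset.sum_comm]
    refine Finset.sum_congr rfl fun z _ => ?_
    rw [Finset.sum_comm]
    refine Finset.sum_congr rfl fun c _ => ?_
    generalize Real.log (mixOut B (fun l => c (m, l)) z / push B κ z) = G
    rw [mixOut, Finset.mul_sum, Finset.sum_mul, Finset.mul_sum]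
    exact Finset.sum_congr rfl fun l _ => by ring
  rw [e1]
  calc _ ≤ ∑ z, (1 / (L : ℝ)) * ∑ _l : Fin L,
        ∑ v, κ v * (B v z * Real.log (1 + B v z / (L * push B κ z))) :=
        Finset.sum_le_sum fun z _ => mul_le_mul_of_nonneg_left
          (Finset.sum_le_sum fun l _ => hterm z l) (by positivity)
    _ = _ := by
        simp only [Finset.sum_const, Finset.card_univ, Fintype.card_fin, nsmul_eq_mul,
          Finset.mul_sum]
        rw [Finset.sum_comm]
        refine Finset.sum_congr rfl fun v _ => Finset.sum_congr rfl fun z _ => ?_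
        field_simp

/-- Markov's inequality: at least half of `2 * N` indices have a value of at most twice the
average. -/
theorem exists_embedding_le {N : ℕ} {F : Fin (2 * N) → ℝ} (hF : ∀ m, 0 ≤ F m) {τ : ℝ}
    (hτ : 0 < τ) (h : ∑ m, F m ≤ (2 * N : ℕ) * τ) :
    ∃ f : Fin N ↪ Fin (2 * N), ∀ m, F (f m) ≤ 2 * τ := by
  classical
  have hbad : ((Finset.univ.filter fun m => ¬ F m ≤ 2 * τ).card : ℝ) * (2 * τ) ≤
      (2 * N : ℕ) * τ := by
    refine le_trans ?_ h
    rw [← nsmul_eq_mul, ← Finset.sum_const]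
    refine (Finset.sum_le_sum fun m hm => (not_le.1 (Finset.mem_filter.1 hm).2).le).trans ?_
    exact Finset.sum_le_sum_of_subset_of_nonneg (Finset.filter_subset _ _) fun m _ _ => hF m
  have hbad' : (Finset.univ.filter fun m => ¬ F m ≤ 2 * τ).card ≤ N := by
    have : ((Finset.univ.filter fun m => ¬ F m ≤ 2 * τ).card : ℝ) ≤ N := by
      push_cast at hbad
      have h2 : (0 : ℝ) < 2 * τ := by positivity
      refine le_of_mul_le_mul_right ?_ h2
      linarith
    exact_mod_cast this
  have hsplit := Finset.card_filter_add_card_filter_not (s := (Finset.univ : Finset (Fin (2 * N))))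
    fun m => F m ≤ 2 * τ
  rw [Finset.card_univ, Fintype.card_fin] at hsplit
  have hgood : N ≤ Fintype.card {m // F m ≤ 2 * τ} := by
    rw [Fintype.card_subtype]
    omega
  obtain ⟨f⟩ : Nonempty (Fin N ↪ {m // F m ≤ 2 * τ}) :=
    Function.Embedding.nonempty_of_card_le (by simpa using hgood)
  exact ⟨f.trans (Function.Embedding.subtype _), fun m => (f m).2⟩

open Classical in
/-- The one-shot wiretap coding theorem with guarantees for each message. -/
theorem exists_oneShot_code {N L : ℕ} (hN : 0 < N) (hL : 0 < L) {κ : V → ℝ}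
    (hκ0 : ∀ v, 0 ≤ κ v) (hκ : ∑ v, κ v = 1) {A : V → Y → ℝ} (hA0 : ∀ v y, 0 ≤ A v y)
    (hA : ∀ v, ∑ y, A v y = 1) {B : V → Z → ℝ} (hB0 : ∀ v z, 0 ≤ B v z)
    (hB : ∀ v, ∑ z, B v z = 1) {d : V → ℝ} (hd : ∀ v, 0 ≤ d v) {T τ : ℝ} (hT : 0 < T) (hτ : 0 < τ)
    (h : ∑ v, κ v * (∑ y, if T * push A κ y ≤ A v y then 0 else A v y) + (2 * N : ℕ) * L / T +
      ∑ v, κ v * (∑ z, B v z * Real.log (1 + B v z / (L * push B κ z))) +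
      ∑ v, κ v * d v ≤ τ) :
    ∃ (c : Fin N → Fin L → V) (dec : Y → Fin N), (∀ m l, 0 < κ (c m l)) ∧ ∀ m,
      ∑ y, (if dec y ≠ m then mixOut A (c m) y else 0) ≤ 2 * τ ∧
      ∑ z, mixOut B (c m) z * Real.log (mixOut B (c m) z / push B κ z) ≤ 2 * τ ∧
      (1 / (L : ℝ)) * ∑ l, d (c m l) ≤ 2 * τ := by
  have hM : 0 < 2 * N := by omega
  have hL' : (0 : ℝ) < L := by exact_mod_cast hL
  -- The codebook has 2N messages, twice the number needed, to allow for expurgation.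
  let dec₀ := thresholdDec (L := L) hM fun v y => T * push A κ y ≤ A v y
  let F₁ : (Fin (2 * N) × Fin L → V) → Fin (2 * N) → ℝ := fun c m =>
    (1 / (L : ℝ)) * ∑ l, ∑ y, A (c (m, l)) y * (if dec₀ c y ≠ m then 1 else 0)
  let F₂ : (Fin (2 * N) × Fin L → V) → Fin (2 * N) → ℝ := fun c m =>
    ∑ z, mixOut B (fun l => c (m, l)) z *
      Real.log (mixOut B (fun l => c (m, l)) z / push B κ z)
  let F₃ : (Fin (2 * N) × Fin L → V) → Fin (2 * N) → ℝ := fun c m =>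
    (1 / (L : ℝ)) * ∑ l, d (c (m, l))
  have hF₁ : ∀ m, ∑ c, (∏ k, κ (c k)) * F₁ c m ≤
      ∑ v, κ v * (∑ y, if T * push A κ y ≤ A v y then 0 else A v y) + (2 * N : ℕ) * L / T := by
    intro m
    have e : ∑ c, (∏ k, κ (c k)) * F₁ c m = (1 / (L : ℝ)) * ∑ l, ∑ c : Fin (2 * N) × Fin L → V,
        (∏ k, κ (c k)) * ∑ y, A (c (m, l)) y * (if dec₀ c y ≠ m then 1 else 0) := by
      rw [Finset.sum_comm, Finset.mul_sum]
      refine Finset.sum_congr rfl fun c _ => ?_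
      simp only [F₁]
      rw [mul_left_comm, Finset.mul_sum]
    rw [e]
    refine (mul_le_mul_of_nonneg_left (Finset.sum_le_sum fun l _ =>
      threshold_error hM hκ0 hκ hA0 hA hT m l) (by positivity)).trans (le_of_eq ?_)
    rw [Finset.sum_const, Finset.card_univ, Fintype.card_fin, nsmul_eq_mul, ← mul_assoc,
      one_div_mul_cancel hL'.ne', one_mul]
  have hF₃ : ∀ m, ∑ c, (∏ k, κ (c k)) * F₃ c m = ∑ v, κ v * d v := by
    intro m
    have e : ∑ c, (∏ k, κ (c k)) * F₃ c m = (1 / (L : ℝ)) * ∑ l, ∑ c : Fin (2 * N) × Fin L → V,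
        (∏ k, κ (c k)) * d (c (m, l)) := by
      rw [Finset.sum_comm, Finset.mul_sum]
      refine Finset.sum_congr rfl fun c _ => ?_
      simp only [F₃]
      rw [mul_left_comm, Finset.mul_sum]
    rw [e, Finset.sum_congr rfl fun l _ => sum_codebook_mul hκ (m, l) d, Finset.sum_const,
      Finset.card_univ, Fintype.card_fin, nsmul_eq_mul, ← mul_assoc,
      one_div_mul_cancel hL'.ne', one_mul]
  -- The three quantities are added so that a single codebook, and then a single set of messages,
  -- controls them all. Each is nonnegative, so a bound on the sum bounds each.
  have hsum : ∑ c, (∏ k, κ (c k)) * ∑ m, (F₁ c m + F₂ c m + F₃ c m) ≤ (2 * N : ℕ) * τ := by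
    simp only [Finset.mul_sum]
    rw [Finset.sum_comm]
    refine (Finset.sum_le_sum fun m _ => (?_ : _ ≤ τ)).trans ?_
    · simp only [mul_add, Finset.sum_add_distrib]
      refine le_trans ?_ h
      exact add_le_add (add_le_add (hF₁ m) (soft_covering hL hκ0 hκ hB0 m)) (hF₃ m).le
    · rw [Finset.sum_const, Finset.card_univ, Fintype.card_fin, nsmul_eq_mul]
  obtain ⟨c, hc, hcF⟩ := exists_le_of_weighted_sum_le
    (fun c => Finset.prod_nonneg fun k _ => hκ0 (c k)) (sum_codebook hκ) hsum
  have hcpos : ∀ i, 0 < κ (c i) := fun i => lt_of_le_of_ne (hκ0 _) fun h0 =>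
    hc.ne' (Finset.prod_eq_zero (Finset.mem_univ i) h0.symm)
  have h1 : ∀ m, 0 ≤ F₁ c m := fun m => mul_nonneg (by positivity)
    (Finset.sum_nonneg fun l _ => Finset.sum_nonneg fun y _ => mul_nonneg (hA0 _ _)
      (by split_ifs <;> norm_num))
  have h2 : ∀ m, 0 ≤ F₂ c m := fun m => gibbs (mixOut_nonneg hB0 _) (push_nonneg hκ0 hB0)
    (fun z hz => push_pos_of_mixOut_pos hκ0 hB0 (fun l => hcpos (m, l)) hz)
    (by rw [sum_push hB, hκ, sum_mixOut hL hB])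
  have h3 : ∀ m, 0 ≤ F₃ c m := fun m => mul_nonneg (by positivity)
    (Finset.sum_nonneg fun l _ => hd _)
  obtain ⟨f, hf⟩ := exists_embedding_le (fun m => add_nonneg (add_nonneg (h1 m) (h2 m)) (h3 m))
    hτ hcF
  have : Nonempty (Fin N) := ⟨⟨0, hN⟩⟩
  -- Decisions for discarded messages are mapped arbitrarily, which can only remove errors.
  refine ⟨fun m l => c (f m, l), fun y => Function.invFun f (dec₀ c y), fun m l => hcpos _,
    fun m => ⟨?_, ?_, ?_⟩⟩
  · refine le_trans ?_ (show F₁ c (f m) ≤ 2 * τ by linarith [hf m, h2 (f m), h3 (f m)])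
    simp only [F₁]
    rw [Finset.sum_comm, Finset.mul_sum]
    refine Finset.sum_le_sum fun y _ => ?_
    by_cases hy : dec₀ c y = f m
    · simp only [hy, Function.leftInverse_invFun f.injective m, ne_eq, not_true_eq_false, if_false]
      simp
    · simp only [ne_eq, hy, not_false_eq_true, if_true, mul_one]
      split_ifs
      exacts [mixOut_nonneg hA0 _ _, le_rfl]
  · exact show F₂ c (f m) ≤ 2 * τ by linarith [hf m, h1 (f m), h3 (f m)]
  · exact show F₃ c (f m) ≤ 2 * τ by linarith [hf m, h1 (f m), h2 (f m)]

end OneShot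

/-! ### Exponential bounds for memoryless extensions -/

section Exponents

/-- The moment generating function of f - a equals 1 at zero and has negative derivative there, so
it drops below 1 for small positive ρ. This is the Chernoff exponent behind all three block bounds.
-/
theorem exists_moment_lt_one {Ω : Type*} [Fintype Ω] {p : Ω → ℝ} (hp1 : ∑ ω, p ω = 1)
    {f : Ω → ℝ} {a : ℝ} (ha : ∑ ω, p ω * f ω < a) :
    ∃ ρ : ℝ, 0 < ρ ∧ ρ ≤ 1 ∧ ∑ ω, p ω * Real.exp (ρ * (f ω - a)) < 1 := by
  set g : ℝ → ℝ := fun ρ => ∑ ω, p ω * Real.exp (ρ * (f ω - a))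
  have hg0 : g 0 = 1 := by simp [g, hp1]
  have hderiv : HasDerivAt g (∑ ω, p ω * (f ω - a)) 0 := by
    refine HasDerivAt.fun_sum fun ω _ => ?_
    have h := (((hasDerivAt_id (0 : ℝ)).mul_const (f ω - a)).exp).const_mul (p ω)
    simpa using h
  have hneg : ∑ ω, p ω * (f ω - a) < 0 := by
    simp only [mul_sub, Finset.sum_sub_distrib, ← Finset.sum_mul, hp1, one_mul]
    linarith
  have h1 := (hasDerivAt_iff_tendsto_slope_zero.1 hderiv).eventually (gt_mem_nhds hneg)
  have h2 : ∀ᶠ t in nhdsWithin (0 : ℝ) (Set.Ioi 0), t⁻¹ • (g (0 + t) - g 0) < 0 :=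
    h1.filter_mono (nhdsWithin_mono _ fun t ht => ne_of_gt ht)
  obtain ⟨t, ht, ht'⟩ := (h2.and (Ioo_mem_nhdsGT (zero_lt_one' ℝ))).exists
  refine ⟨t, ht'.1, ht'.2.le, ?_⟩
  rw [zero_add, hg0, smul_eq_mul] at ht
  by_contra hcon
  exact ht.not_ge (mul_nonneg (inv_nonneg.2 ht'.1.le) (sub_nonneg.2 (not_lt.1 hcon)))

/-- Subadditivity gives (1 + x) ^ ρ ≤ 1 + x ^ ρ, and then log(1 + s) ≤ s. The logarithm in the
covering bound is thus traded for an exponential moment, which factors over letters. -/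
theorem log_one_add_le {ρ x t : ℝ} (hρ : 0 < ρ) (hρ1 : ρ ≤ 1) (hx : 0 ≤ x)
    (hxt : x ≤ Real.exp t) : Real.log (1 + x) ≤ (1 / ρ) * Real.exp (ρ * t) := by
  have h1 : (1 + x) ^ ρ ≤ 1 + x ^ ρ := by
    simpa using Real.rpow_add_le_add_rpow zero_le_one hx hρ.le hρ1
  have h2 : x ^ ρ ≤ Real.exp (ρ * t) := by
    refine (Real.rpow_le_rpow hx hxt hρ.le).trans (le_of_eq ?_)
    rw [← Real.exp_mul, mul_comm]
  have h3 : ρ * Real.log (1 + x) ≤ Real.exp (ρ * t) := by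
    rw [← Real.log_rpow (by linarith)]
    refine (Real.log_le_sub_one_of_pos (by positivity)).trans ?_
    linarith
  rw [one_div, ← div_eq_inv_mul, le_div_iff₀ hρ, mul_comm]
  exact h3

variable {U V O : Type*} [Fintype U] [Fintype V] [Fintype O] {n : ℕ}

/-- The memoryless extension of a kernel. -/
def powKer {α β : Type*} {n : ℕ} (A : α → β → ℝ) (v : Fin n → α) (y : Fin n → β) : ℝ :=
  ∏ i, A (v i) (y i)

theorem powKer_nonneg {α β : Type*} {A : α → β → ℝ} (hA : ∀ v y, 0 ≤ A v y) (v : Fin n → α)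
    (y : Fin n → β) : 0 ≤ powKer A v y := Finset.prod_nonneg fun _ _ => hA _ _

theorem sum_powKer {α : Type*} {A : α → O → ℝ} (hA : ∀ v, ∑ y, A v y = 1) (v : Fin n → α) :
    ∑ y, powKer A v y = 1 := by
  simp only [powKer, sum_pi_prod fun i => A (v i), hA, Finset.prod_const_one]

theorem push_powKer (A : V → O → ℝ) (κ : U → V → ℝ) (u : Fin n → U) (y : Fin n → O) :
    push (powKer A) (powKer κ u) y = ∏ i, push A (κ (u i)) (y i) := by
  simp only [push, powKer, ← Finset.prod_mul_distrib]
  exact sum_pi_prod fun i v => κ (u i) v * A v (y i)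

theorem sum_pi_prod₃ (F : U → V → O → ℝ) :
    ∑ u : Fin n → U, ∑ v : Fin n → V, ∑ y : Fin n → O, ∏ i, F (u i) (v i) (y i) =
      (∑ u, ∑ v, ∑ y, F u v y) ^ n := by
  have h1 : ∀ (u : Fin n → U) (v : Fin n → V), ∑ y : Fin n → O, ∏ i, F (u i) (v i) (y i) =
      ∏ i, ∑ y, F (u i) (v i) y := fun u v => sum_pi_prod fun i => F (u i) (v i)
  have h2 : ∀ u : Fin n → U, ∑ v : Fin n → V, ∏ i, ∑ y, F (u i) (v i) y =
      ∏ i, ∑ v, ∑ y, F (u i) v y := fun u => sum_pi_prod fun i v => ∑ y, F (u i) v y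
  simp only [h1, h2]
  rw [sum_pi_prod fun _ u => ∑ v, ∑ y, F u v y, Finset.prod_const, Finset.card_univ,
    Fintype.card_fin]

variable {lam : U → ℝ} {κ : U → V → ℝ} {A : V → O → ℝ}

/-- The information density of the test channel. -/
def infoDensity (κ : U → V → ℝ) (A : V → O → ℝ) (u : U) (v : V) (y : O) : ℝ :=
  Real.log (A v y / push A (κ u) y)

/-- Positivity is essential: where a ratio vanishes, `Real.log` takes the default value 0 and its
exponential is not the ratio. -/
theorem exp_sum_infoDensity (hκ : ∀ u v, 0 ≤ κ u v) (hA : ∀ v y, 0 ≤ A v y)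
    {u : Fin n → U} {v : Fin n → V} {y : Fin n → O} (h : ∀ i, 0 < κ (u i) (v i) * A (v i) (y i)) :
    0 < push (powKer A) (powKer κ u) y ∧
      Real.exp (∑ i, infoDensity κ A (u i) (v i) (y i)) =
        powKer A v y / push (powKer A) (powKer κ u) y := by
  have hQ : ∀ i, 0 < push A (κ (u i)) (y i) := fun i => push_pos (hκ _) hA (h i)
  have hA' : ∀ i, 0 < A (v i) (y i) := fun i =>
    lt_of_le_of_ne (hA _ _) fun h0 => by simpa [← h0] using h i
  rw [push_powKer]
  refine ⟨Finset.prod_pos fun i _ => hQ i, ?_⟩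
  rw [Real.exp_sum, powKer, ← Finset.prod_div_distrib]
  exact Finset.prod_congr rfl fun i _ => Real.exp_log (div_pos (hA' i) (hQ i))

theorem prod_mul_exp (w g : Fin n → ℝ) (ρ : ℝ) :
    ∏ i, w i * Real.exp (ρ * g i) = (∏ i, w i) * Real.exp (ρ * ∑ i, g i) := by
  rw [Finset.prod_mul_distrib, Finset.mul_sum, Real.exp_sum]

theorem weights_prod (lam : U → ℝ) (κ : U → V → ℝ) (A : V → O → ℝ) (u : Fin n → U)
    (v : Fin n → V) (y : Fin n → O) : ∏ i, lam (u i) * κ (u i) (v i) * A (v i) (y i) =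
      (∏ i, lam (u i)) * (powKer κ u v * powKer A v y) := by
  simp only [Finset.prod_mul_distrib, powKer, mul_assoc]

/-- Chernoff's bound for the lower tail of the information density: on failure of the test the
exponential factor is at least one. The total factors over letters into an n-th power. -/
theorem sum_threshold_le (hlam : ∀ u, 0 ≤ lam u) (hκ : ∀ u v, 0 ≤ κ u v) (hA : ∀ v y, 0 ≤ A v y)
    {a ρ : ℝ} (hρ : 0 < ρ) : ∑ u : Fin n → U, (∏ i, lam (u i)) * ∑ v, powKer κ u v *
      (∑ y, if Real.exp (n * a) * push (powKer A) (powKer κ u) y ≤ powKer A v y then 0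
        else powKer A v y) ≤
      (∑ u, ∑ v, ∑ y, lam u * κ u v * A v y *
        Real.exp (ρ * (- infoDensity κ A u v y - -a))) ^ n := by
  rw [← sum_pi_prod₃]
  simp only [Finset.mul_sum]
  refine Finset.sum_le_sum fun u _ => Finset.sum_le_sum fun v _ => Finset.sum_le_sum fun y _ => ?_
  rw [prod_mul_exp, weights_prod]
  set w := (∏ i, lam (u i)) * (powKer κ u v * powKer A v y) with hw
  have hw0 : 0 ≤ w := mul_nonneg (Finset.prod_nonneg fun i _ => hlam _)
    (mul_nonneg (powKer_nonneg hκ _ _) (powKer_nonneg hA _ _))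
  split_ifs with h
  · rw [mul_zero, mul_zero]
    positivity
  rcases hw0.eq_or_lt with h0 | h0
  · rw [← h0, ← hw, ← h0, zero_mul]
  rw [← hw]
  refine le_mul_of_one_le_right hw0 ?_
  rw [← weights_prod] at hw
  have hpos : ∀ i, 0 < κ (u i) (v i) * A (v i) (y i) := fun i =>
    lt_of_le_of_ne (mul_nonneg (hκ _ _) (hA _ _)) fun hi => h0.ne' (by
      rw [hw]
      exact Finset.prod_eq_zero (Finset.mem_univ i) (by rw [mul_assoc, ← hi, mul_zero]))
  obtain ⟨hQ, hexp⟩ := exp_sum_infoDensity hκ hA hpos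
  rw [not_le, ← div_lt_iff₀ hQ, ← hexp, Real.exp_lt_exp] at h
  rw [Real.one_le_exp_iff]
  refine mul_nonneg hρ.le ?_
  simp only [sub_neg_eq_add, Finset.sum_add_distrib, Finset.sum_neg_distrib, Finset.sum_const,
    Finset.card_univ, Fintype.card_fin, nsmul_eq_mul]
  linarith

/-- Since L ≥ exp(n a), the ratio inside the logarithm is at most the exponential of the summed
density minus n a, and `log_one_add_le` applies. -/
theorem sum_cover_le (hlam : ∀ u, 0 ≤ lam u) (hκ : ∀ u v, 0 ≤ κ u v) (hA : ∀ v y, 0 ≤ A v y)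
    {a ρ L : ℝ} (hρ : 0 < ρ) (hρ1 : ρ ≤ 1) (hL : Real.exp (n * a) ≤ L) :
    ∑ u : Fin n → U, (∏ i, lam (u i)) * ∑ v, powKer κ u v *
      (∑ y, powKer A v y * Real.log (1 + powKer A v y /
        (L * push (powKer A) (powKer κ u) y))) ≤
      (1 / ρ) * (∑ u, ∑ v, ∑ y, lam u * κ u v * A v y *
        Real.exp (ρ * (infoDensity κ A u v y - a))) ^ n := by
  rw [← sum_pi_prod₃]
  simp only [Finset.mul_sum]
  refine Finset.sum_le_sum fun u _ => Finset.sum_le_sum fun v _ => Finset.sum_le_sum fun y _ => ?_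
  rw [prod_mul_exp, weights_prod]
  have hL0 : 0 < L := (Real.exp_pos _).trans_le hL
  set w := (∏ i, lam (u i)) * (powKer κ u v * powKer A v y) with hw
  have hw0 : 0 ≤ w := mul_nonneg (Finset.prod_nonneg fun i _ => hlam _)
    (mul_nonneg (powKer_nonneg hκ _ _) (powKer_nonneg hA _ _))
  rw [← mul_assoc (powKer κ u v), ← mul_assoc (∏ i, lam (u i)), ← hw, mul_left_comm]
  rcases hw0.eq_or_lt with h0 | h0
  · rw [← h0, zero_mul, zero_mul]
  refine mul_le_mul_of_nonneg_left ?_ hw0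
  rw [← weights_prod] at hw
  have hpos : ∀ i, 0 < κ (u i) (v i) * A (v i) (y i) := fun i =>
    lt_of_le_of_ne (mul_nonneg (hκ _ _) (hA _ _)) fun hi => h0.ne' (by
      rw [hw]
      exact Finset.prod_eq_zero (Finset.mem_univ i) (by rw [mul_assoc, ← hi, mul_zero]))
  obtain ⟨hQ, hexp⟩ := exp_sum_infoDensity hκ hA hpos
  refine log_one_add_le hρ hρ1 (div_nonneg (powKer_nonneg hA _ _) (mul_pos hL0 hQ).le) ?_
  rw [Finset.sum_sub_distrib, Finset.sum_const, Finset.card_univ, Fintype.card_fin, nsmul_eq_mul,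
    Real.exp_sub, hexp, div_div, mul_comm L]
  refine div_le_div_of_nonneg_left (powKer_nonneg hA _ _) (by positivity) ?_
  exact mul_le_mul_of_nonneg_left hL hQ.le

theorem sum_cost_le (hlam : ∀ u, 0 ≤ lam u) (hκ : ∀ u v, 0 ≤ κ u v) (γ : V → ℝ)
    {a ρ : ℝ} (hρ : 0 < ρ) : ∑ u : Fin n → U, (∏ i, lam (u i)) * ∑ v, powKer κ u v *
      (if ∑ i, γ (v i) ≤ n * a then 0 else 1) ≤
      (∑ u, ∑ v, lam u * κ u v * Real.exp (ρ * (γ v - a))) ^ n := by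
  have h := sum_pi_prod₃ (n := n) (O := Unit)
    fun u v _ => lam u * κ u v * Real.exp (ρ * (γ v - a))
  simp only [Finset.univ_unique, Finset.sum_singleton] at h
  rw [← h]
  simp only [Finset.mul_sum]
  refine Finset.sum_le_sum fun u _ => Finset.sum_le_sum fun v _ => ?_
  rw [prod_mul_exp, Finset.prod_mul_distrib, ← mul_assoc]
  have hw0 : 0 ≤ (∏ i, lam (u i)) * ∏ i, κ (u i) (v i) :=
    mul_nonneg (Finset.prod_nonneg fun i _ => hlam _) (Finset.prod_nonneg fun i _ => hκ _ _)
  refine mul_le_mul_of_nonneg_left ?_ hw0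
  split_ifs with h
  · positivity
  · rw [Real.one_le_exp_iff]
    refine mul_nonneg hρ.le ?_
    simp only [Finset.sum_sub_distrib, Finset.sum_const, Finset.card_univ, Fintype.card_fin,
      nsmul_eq_mul]
    linarith

end Exponents

/-! ### Wiretap codes -/

section BlockCode

variable {U V Y Z : Type*} [Fintype U] [Fintype V] [Fintype Y] [Fintype Z]

/-- The conditional mutual information, in bits, of the test channel `A` with the input law
`lam u * κ u v`, given `u`. -/
def testInfo {O : Type*} [Fintype O] (lam : U → ℝ) (κ : U → V → ℝ) (A : V → O → ℝ) : ℝ :=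
  ∑ u, lam u * kernelInfo (κ u) A

theorem sum_infoDensity {O : Type*} [Fintype O] (lam : U → ℝ) (κ : U → V → ℝ) (A : V → O → ℝ) :
    ∑ t : U × V × O, lam t.1 * κ t.1 t.2.1 * A t.2.1 t.2.2 *
      infoDensity κ A t.1 t.2.1 t.2.2 = testInfo lam κ A * Real.log 2 := by
  have hlog2 : Real.log 2 ≠ 0 := (Real.log_pos one_lt_two).ne'
  simp only [testInfo, Finset.sum_mul, Fintype.sum_prod_type]
  refine Finset.sum_congr rfl fun u _ => ?_
  rw [kernelInfo_eq_log, mul_assoc, div_mul_cancel₀ _ hlog2, Fintype.sum_prod_type, Finset.mul_sum]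
  refine Finset.sum_congr rfl fun v _ => ?_
  rw [Finset.mul_sum]
  refine Finset.sum_congr rfl fun o _ => ?_
  by_cases h : κ u v = 0
  · simp [h]
  · rw [mul_div_mul_left _ _ h, infoDensity]
    ring

/-- The sign `s = -1` serves the lower tail used in decoding, `s = 1` the upper tail used in
covering. -/
theorem exists_infoDensity_moment {O : Type*} [Fintype O] {lam : U → ℝ} (hlam1 : ∑ u, lam u = 1)
    {κ : U → V → ℝ} (hκ1 : ∀ u, ∑ v, κ u v = 1) {A : V → O → ℝ} (hA1 : ∀ v, ∑ y, A v y = 1)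
    (s : ℝ) {a : ℝ} (ha : s * (testInfo lam κ A * Real.log 2) < a) :
    ∃ ρ : ℝ, 0 < ρ ∧ ρ ≤ 1 ∧ ∑ u, ∑ v, ∑ y, lam u * κ u v * A v y *
      Real.exp (ρ * (s * infoDensity κ A u v y - a)) < 1 := by
  have h := exists_moment_lt_one (Ω := U × V × O)
    (p := fun t => lam t.1 * κ t.1 t.2.1 * A t.2.1 t.2.2)
    (f := fun t => s * infoDensity κ A t.1 t.2.1 t.2.2) (a := a)
    (by simp only [Fintype.sum_prod_type, ← Finset.mul_sum, hA1, mul_one, hκ1, hlam1])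
    (by
      refine lt_of_eq_of_lt ?_ ha
      rw [← sum_infoDensity, Finset.mul_sum]
      exact Finset.sum_congr rfl fun t _ => by ring)
  simpa only [Fintype.sum_prod_type] using h

open Classical in
/-- Existence of wiretap codes over a test channel at all rates below the difference of the
mutual informations. -/
theorem eventually_exists_block_code {lam : U → ℝ} (hlam : ∀ u, 0 ≤ lam u)
    (hlam1 : ∑ u, lam u = 1) {κ : U → V → ℝ} (hκ : ∀ u v, 0 ≤ κ u v)
    (hκ1 : ∀ u, ∑ v, κ u v = 1) {A : V → Y → ℝ} (hA : ∀ v y, 0 ≤ A v y)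
    (hA1 : ∀ v, ∑ y, A v y = 1) {B : V → Z → ℝ} (hB : ∀ v z, 0 ≤ B v z)
    (hB1 : ∀ v, ∑ z, B v z = 1) (γ : V → ℝ) {a : ℝ} (ha : ∑ u, ∑ v, lam u * κ u v * γ v < a)
    {R : ℝ} (hR0 : 0 ≤ R) (hR : R < testInfo lam κ A - testInfo lam κ B) {ε : ℝ} (hε : 0 < ε) :
    ∀ᶠ n : ℕ in atTop, ∃ (L : ℕ) (u : Fin n → U) (c : Msg n R → Fin L → Fin n → V)
      (dec : (Fin n → Y) → Msg n R), 0 < L ∧ (∀ m l, 0 < powKer κ u (c m l)) ∧ ∀ m,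
      ∑ y, (if dec y ≠ m then mixOut (powKer A) (c m) y else 0) ≤ ε ∧
      ∑ z, mixOut (powKer B) (c m) z *
        Real.log (mixOut (powKer B) (c m) z / push (powKer B) (powKer κ u) z) ≤ ε ∧
      (1 / (L : ℝ)) * ∑ l, (if ∑ i, γ (c m l i) ≤ n * a then 0 else 1) ≤ ε := by
  have hlog2 : 0 < Real.log 2 := Real.log_pos one_lt_two
  have hIB : 0 ≤ testInfo lam κ B := Finset.sum_nonneg fun u _ =>
    mul_nonneg (hlam u) (kernelInfo_nonneg (hκ u) (hκ1 u) hB hB1)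
  set IA := testInfo lam κ A * Real.log 2
  set IB := testInfo lam κ B * Real.log 2
  have hR' : R * Real.log 2 < IA - IB := by
    rw [← sub_mul]
    exact mul_lt_mul_of_pos_right hR hlog2
  -- A third of the slack, in nats: R ln 2 + (IB + δ) = (IA - δ) - δ, so the number of codewords
  -- over the threshold decays like exp(-nδ).
  set δ := (IA - IB - R * Real.log 2) / 3 with hδ
  have hδ0 : 0 < δ := by linarith
  have hIB0 : 0 ≤ IB := mul_nonneg hIB hlog2.le
  obtain ⟨ρ₁, hρ₁, -, hm₁⟩ := exists_infoDensity_moment hlam1 hκ1 hA1 (-1) (a := -(IA - δ))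
    (by change -1 * IA < _; linarith)
  obtain ⟨ρ₂, hρ₂, hρ₂1, hm₂⟩ := exists_infoDensity_moment hlam1 hκ1 hB1 1 (a := IB + δ)
    (by change 1 * IB < _; linarith)
  obtain ⟨ρ₃, hρ₃, -, hm₃⟩ := exists_moment_lt_one (Ω := U × V)
    (p := fun t => lam t.1 * κ t.1 t.2) (f := fun t => γ t.2) (a := a)
    (by simp only [Fintype.sum_prod_type, ← Finset.mul_sum, hκ1, mul_one, hlam1])
    (by simpa only [Fintype.sum_prod_type] using ha)
  simp only [neg_one_mul] at hm₁
  simp only [one_mul] at hm₂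
  simp only [Fintype.sum_prod_type] at hm₃
  set x₁ := ∑ u, ∑ v, ∑ y, lam u * κ u v * A v y *
    Real.exp (ρ₁ * (- infoDensity κ A u v y - -(IA - δ)))
  set x₂ := ∑ u, ∑ v, ∑ y, lam u * κ u v * B v y *
    Real.exp (ρ₂ * (infoDensity κ B u v y - (IB + δ)))
  set x₃ := ∑ u, ∑ v, lam u * κ u v * Real.exp (ρ₃ * (γ v - a))
  have hx₁ : 0 ≤ x₁ := Finset.sum_nonneg fun u _ => Finset.sum_nonneg fun v _ =>
    Finset.sum_nonneg fun y _ =>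
      mul_nonneg (mul_nonneg (mul_nonneg (hlam _) (hκ _ _)) (hA _ _)) (Real.exp_pos _).le
  have hx₂ : 0 ≤ x₂ := Finset.sum_nonneg fun u _ => Finset.sum_nonneg fun v _ =>
    Finset.sum_nonneg fun y _ =>
      mul_nonneg (mul_nonneg (mul_nonneg (hlam _) (hκ _ _)) (hB _ _)) (Real.exp_pos _).le
  have hx₃ : 0 ≤ x₃ := Finset.sum_nonneg fun u _ => Finset.sum_nonneg fun v _ =>
    mul_nonneg (mul_nonneg (hlam _) (hκ _ _)) (Real.exp_pos _).le
  -- The factor 4 pays for the doubled message set and for rounding L up. The target is ε/2 because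
  -- expurgation doubles the bound.
  have hlim : Tendsto (fun n : ℕ => x₁ ^ n + 4 * Real.exp (-δ) ^ n + (1 / ρ₂) * x₂ ^ n + x₃ ^ n)
      atTop (nhds (0 + 4 * 0 + (1 / ρ₂) * 0 + 0)) :=
    (((tendsto_pow_atTop_nhds_zero_of_lt_one hx₁ hm₁).add
      ((tendsto_pow_atTop_nhds_zero_of_lt_one (Real.exp_pos _).le
        (by rw [← Real.exp_zero]; exact Real.exp_lt_exp.2 (by linarith))).const_mul 4)).add
      ((tendsto_pow_atTop_nhds_zero_of_lt_one hx₂ hm₂).const_mul _)).add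
      (tendsto_pow_atTop_nhds_zero_of_lt_one hx₃ hm₃)
  have hlt : (0 + 4 * 0 + (1 / ρ₂) * 0 + 0 : ℝ) < ε / 2 := by
    simp only [mul_zero, add_zero]
    exact half_pos hε
  filter_upwards [hlim.eventually (gt_mem_nhds hlt)] with n hn
  set N := ⌊(2 : ℝ) ^ ((n : ℝ) * R)⌋₊
  set L := ⌈Real.exp (n * (IB + δ))⌉₊
  have hN : 0 < N := Nat.floor_pos.2 (one_le_rpow_two n hR0)
  have hL : 0 < L := Nat.ceil_pos.2 (Real.exp_pos _)
  have hLge : Real.exp (n * (IB + δ)) ≤ L := Nat.le_ceil _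
  have hexp1 : 1 ≤ Real.exp (n * (IB + δ)) := Real.one_le_exp (by positivity)
  have hLle : (L : ℝ) ≤ 2 * Real.exp (n * (IB + δ)) := by
    have := Nat.ceil_lt_add_one (Real.exp_pos (n * (IB + δ))).le
    linarith
  have hNle : (N : ℝ) ≤ Real.exp (n * (R * Real.log 2)) := by
    refine (Nat.floor_le (by positivity)).trans (le_of_eq ?_)
    rw [Real.rpow_def_of_pos two_pos]
    congr 1
    ring
  set T := Real.exp (n * (IA - δ)) with hT
  have hT0 : 0 < T := Real.exp_pos _
  have hcount : (2 * N : ℕ) * (L : ℝ) / T ≤ 4 * Real.exp (-δ) ^ n := by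
    rw [div_le_iff₀ hT0]
    push_cast
    have e : 4 * Real.exp (-δ) ^ n * T =
        2 * Real.exp (n * (R * Real.log 2)) * (2 * Real.exp (n * (IB + δ))) := by
      have : Real.exp (-δ) ^ n * T =
          Real.exp (n * (R * Real.log 2)) * Real.exp (n * (IB + δ)) := by
        rw [← Real.exp_nat_mul, hT, ← Real.exp_add, ← Real.exp_add]
        congr 1
        rw [hδ]
        ring
      linear_combination 4 * this
    rw [e]
    have hN0 : (0 : ℝ) ≤ N := N.cast_nonneg
    have hL0 : (0 : ℝ) ≤ L := L.cast_nonneg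
    have hE := Real.exp_pos (n * (R * Real.log 2))
    exact mul_le_mul (by linarith) hLle hL0 (by linarith)
  have hw1 : ∑ u : Fin n → U, ∏ i, lam (u i) = 1 := by
    rw [sum_pi_prod fun _ => lam, hlam1, Finset.prod_const_one]
  have hw0 : ∀ u : Fin n → U, 0 ≤ ∏ i, lam (u i) := fun u => Finset.prod_nonneg fun i _ => hlam _
  let d : (Fin n → V) → ℝ := fun v => if ∑ i, γ (v i) ≤ n * a then 0 else 1
  have hsum : ∑ u : Fin n → U, (∏ i, lam (u i)) *
      (∑ v, powKer κ u v * (∑ y, if T * push (powKer A) (powKer κ u) y ≤ powKer A v y then 0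
        else powKer A v y) + (2 * N : ℕ) * L / T +
      ∑ v, powKer κ u v * (∑ z, powKer B v z *
        Real.log (1 + powKer B v z / (L * push (powKer B) (powKer κ u) z))) +
      ∑ v, powKer κ u v * d v) ≤ ε / 2 := by
    simp only [mul_add, Finset.sum_add_distrib]
    rw [← Finset.sum_mul, hw1, one_mul]
    refine le_trans ?_ hn.le
    exact add_le_add (add_le_add (add_le_add (sum_threshold_le hlam hκ hA hρ₁) hcount)
      (sum_cover_le hlam hκ hB hρ₂ hρ₂1 hLge)) (sum_cost_le hlam hκ γ hρ₃)
  -- The bound is averaged over random u, and one good time-sharing sequence is then fixed. It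
  -- becomes part of the deterministic code design.
  obtain ⟨u, -, hu⟩ := exists_le_of_weighted_sum_le hw0 hw1 hsum
  obtain ⟨c, dec, hc, hcode⟩ := exists_oneShot_code hN hL (powKer_nonneg hκ u)
    (sum_powKer hκ1 u) (powKer_nonneg hA) (sum_powKer hA1) (powKer_nonneg hB) (sum_powKer hB1)
    (d := d) (fun v => by simp only [d]; split_ifs <;> norm_num) hT0 (half_pos hε) hu
  rw [mul_div_cancel₀ _ (two_ne_zero' ℝ)] at hcode
  exact ⟨L, u, c, dec, hL, hc, hcode⟩

end BlockCode

/-! ### Achievability -/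

section Achievability

variable {U V X Y Z : Type*} [Fintype U] [Fintype V] [Fintype X] [Fintype Y] [Fintype Z]

theorem push_mixOut {O : Type*} {L : ℕ} (Γ : X → O → ℝ) (K : V → X → ℝ) (c : Fin L → V) :
    push Γ (mixOut K c) = mixOut (fun v => push Γ (K v)) c := by
  funext o
  simp only [push, mixOut, Finset.mul_sum, Finset.sum_mul]
  rw [Finset.sum_comm]
  exact Finset.sum_congr rfl fun l _ => Finset.sum_congr rfl fun x _ => by ring

theorem sum_pi_prod_mul_apply {n : ℕ} {p : Fin n → X → ℝ} (hp : ∀ i, ∑ x, p i x = 1) (i : Fin n)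
    (f : X → ℝ) : ∑ x : Fin n → X, (∏ j, p j (x j)) * f (x i) = ∑ a, p i a * f a := by
  have h1 : ∀ x : Fin n → X, (∏ j, p j (x j)) * f (x i) =
      ∏ j, p j (x j) * if j = i then f (x j) else 1 := by
    intro x
    rw [Finset.prod_mul_distrib, Finset.prod_ite_eq' Finset.univ i fun j => f (x j)]
    simp
  simp only [h1]
  rw [sum_pi_prod fun j a => p j a * if j = i then f a else 1, Fintype.prod_eq_single i]
  · simp
  · intro j hj
    simp [hj, hp]

theorem sum_powKer_mul_blockCost {n : ℕ} {K : V → X → ℝ} (hK : ∀ v, ∑ x, K v x = 1) (C : X → ℝ)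
    (v : Fin n → V) : ∑ x, powKer K v x * blockCost C x =
      (1 / (n : ℝ)) * ∑ i, ∑ a, K (v i) a * C a := by
  simp only [blockCost, powKer]
  have h : ∀ i, ∑ a, K (v i) a * C a = ∑ x : Fin n → X, (∏ j, K (v j) (x j)) * C (x i) :=
    fun i => (sum_pi_prod_mul_apply (fun j => hK (v j)) i C).symm
  simp only [h, Finset.mul_sum]
  rw [Finset.sum_comm]
  exact Finset.sum_congr rfl fun i _ => Finset.sum_congr rfl fun x _ => by ring

/-- The code that sends a random one of the codewords of the message through the memoryless
extension of the channel `K`. -/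
def codeOfCodebook {C : X → ℝ} {b : ℝ} {n : ℕ} {R : ℝ} {L : ℕ} (hL : 0 < L)
    (K : V → stdSimplex ℝ X) (c : Msg n R → Fin L → Fin n → V) (dec : (Fin n → Y) → Msg n R)
    (hcost : ∀ m, (1 / (L : ℝ)) * ∑ l, (1 / (n : ℝ)) * ∑ i, ∑ a, K (c m l i) a * C a ≤ b) :
    Code X Y C b n R where
  enc m := ⟨mixOut (powKer fun v x => K v x) (c m),
    mixOut_nonneg (powKer_nonneg fun v x => (K v).2.1 x) _,
    sum_mixOut hL (sum_powKer fun v => (K v).2.2) _⟩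
  cost_le m := by
    refine le_trans (le_of_eq ?_) (hcost m)
    have h := fun v => sum_powKer_mul_blockCost (n := n) (K := fun v x => K v x)
      (fun v => (K v).2.2) C v
    rw [← Finset.sum_congr rfl fun l _ => h (c m l), Finset.sum_comm, Finset.mul_sum]
    refine Finset.sum_congr rfl fun x _ => ?_
    change mixOut (powKer fun v x => K v x) (c m) x * blockCost C x = _
    rw [mixOut, mul_assoc, Finset.sum_mul]
  dec := dec

variable {W : X → stdSimplex ℝ (Y × Z)} {C : X → ℝ} {b : ℝ}

theorem mainOut_codeOfCodebook {n : ℕ} {R : ℝ} {L : ℕ} (hL : 0 < L)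
    (K : V → stdSimplex ℝ X) (c : Msg n R → Fin L → Fin n → V) (dec : (Fin n → Y) → Msg n R)
    (hcost : ∀ m, (1 / (L : ℝ)) * ∑ l, (1 / (n : ℝ)) * ∑ i, ∑ a, K (c m l i) a * C a ≤ b)
    (m : Msg n R) : mainOut W (codeOfCodebook hL K c dec hcost) m =
      mixOut (powKer fun v => push (chanY W) (K v)) (c m) := by
  change push (powKer (chanY W)) (mixOut (powKer fun v x => K v x) (c m)) = _
  rw [push_mixOut]
  congr 1
  funext v y
  exact push_powKer _ _ _ _

theorem eavesOut_codeOfCodebook {n : ℕ} {R : ℝ} {L : ℕ} (hL : 0 < L)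
    (K : V → stdSimplex ℝ X) (c : Msg n R → Fin L → Fin n → V) (dec : (Fin n → Y) → Msg n R)
    (hcost : ∀ m, (1 / (L : ℝ)) * ∑ l, (1 / (n : ℝ)) * ∑ i, ∑ a, K (c m l i) a * C a ≤ b)
    (m : Msg n R) : eavesOut W (codeOfCodebook hL K c dec hcost) m =
      mixOut (powKer fun v => push (chanZ W) (K v)) (c m) := by
  change push (powKer (chanZ W)) (mixOut (powKer fun v x => K v x) (c m)) = _
  rw [push_mixOut]
  congr 1
  funext v y
  exact push_powKer _ _ _ _

theorem push_comp {O : Type*} [Fintype O] (Γ : X → O → ℝ) (p : V → ℝ) (K : V → X → ℝ) :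
    push (fun v => push Γ (K v)) p = push Γ (∑ v, p v • K v) := by
  rw [push_sum]
  funext o
  rw [Finset.sum_apply]
  refine Finset.sum_congr rfl fun v _ => ?_
  rw [push_smul, Pi.smul_apply, smul_eq_mul]

theorem testInfo_sub (W : X → stdSimplex ℝ (Y × Z)) {lam : U → ℝ} {κ : U → V → ℝ}
    (hκ : ∀ u v, 0 ≤ κ u v) (K : V → stdSimplex ℝ X) :
    testInfo lam κ (fun v => push (chanY W) (K v)) -
        testInfo lam κ (fun v => push (chanZ W) (K v)) =
      ∑ u, lam u * (entGap W (∑ v, κ u v • (K v : X → ℝ)) - ∑ v, κ u v * entGap W (K v)) := by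
  rw [testInfo, testInfo, ← Finset.sum_sub_distrib]
  refine Finset.sum_congr rfl fun u _ => ?_
  have hY : ∀ v y, 0 ≤ push (chanY W) (K v) y := fun v => push_nonneg (K v).2.1 (chanY_nonneg W)
  have hZ : ∀ v z, 0 ≤ push (chanZ W) (K v) z := fun v => push_nonneg (K v).2.1 (chanZ_nonneg W)
  rw [← mul_sub, kernelInfo_eq_ent (hκ u) hY, kernelInfo_eq_ent (hκ u) hZ,
    push_comp (chanY W) (κ u) fun v x => K v x, push_comp (chanZ W) (κ u) fun v x => K v x]
  congr 1
  simp only [entGap, mul_div_assoc', ← Finset.sum_div, mul_sub, Finset.sum_sub_distrib]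
  ring

/-- Rates below the gain of a test channel that meets the cost constraint are achievable with
semantic security. -/
theorem mem_semRates_of_lt (hC : ∀ x, 0 ≤ C x) {lam : U → ℝ} (hlam : ∀ u, 0 ≤ lam u)
    (hlam1 : ∑ u, lam u = 1) {κ : U → V → ℝ} (hκ : ∀ u v, 0 ≤ κ u v)
    (hκ1 : ∀ u, ∑ v, κ u v = 1) (K : V → stdSimplex ℝ X)
    (hcost : (∀ v, ∑ x, K v x * C x ≤ b) ∨ ∑ u, ∑ v, lam u * κ u v * ∑ x, K v x * C x < b)
    {R : ℝ} (hR0 : 0 ≤ R) (hR : R < ∑ u, lam u *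
      (entGap W (∑ v, κ u v • (K v : X → ℝ)) - ∑ v, κ u v * entGap W (K v))) :
    R ∈ semRates W C b := by
  classical
  set γ : V → ℝ := fun v => ∑ x, K v x * C x with hγ
  have hγ0 : ∀ v, 0 ≤ γ v := fun v => Finset.sum_nonneg fun x _ => mul_nonneg ((K v).2.1 x) (hC x)
  set G := ∑ v, γ v
  have hG : ∀ v, γ v ≤ G := fun v =>
    Finset.single_le_sum (f := γ) (fun v _ => hγ0 v) (Finset.mem_univ v)
  have hG0 : 0 ≤ G := Finset.sum_nonneg fun v _ => hγ0 v
  have hE0 : 0 ≤ ∑ u, ∑ v, lam u * κ u v * γ v := Finset.sum_nonneg fun u _ =>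
    Finset.sum_nonneg fun v _ => mul_nonneg (mul_nonneg (hlam u) (hκ u v)) (hγ0 v)
  -- A small fraction of codewords above the level `a` is turned into an average cost of at most
  -- `b`. If every letter of V meets the constraint this is automatic. Otherwise `a` lies strictly
  -- between the mean cost and `b`, and each exceptional codeword costs at most `G`.
  obtain ⟨a, ha, η, hη, hcode⟩ : ∃ a, ∑ u, ∑ v, lam u * κ u v * γ v < a ∧ ∃ η : ℝ, 0 < η ∧
      ∀ {n : ℕ} {L : ℕ}, 0 < n → 0 < L → ∀ c : Fin L → Fin n → V,
      (1 / (L : ℝ)) * ∑ l, (if ∑ i, γ (c l i) ≤ n * a then 0 else 1) ≤ η →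
      (1 / (L : ℝ)) * ∑ l, (1 / (n : ℝ)) * ∑ i, γ (c l i) ≤ b := by
    have havg : ∀ {n : ℕ} (_ : 0 < n) (v : Fin n → V) (t : ℝ), (∀ i, γ (v i) ≤ t) →
        (1 / (n : ℝ)) * ∑ i, γ (v i) ≤ t := by
      intro n hn v t h
      have hn' : (0 : ℝ) < n := by exact_mod_cast hn
      rw [one_div, inv_mul_le_iff₀ hn']
      refine (Finset.sum_le_sum fun i _ => h i).trans (le_of_eq ?_)
      rw [Finset.sum_const, Finset.card_univ, Fintype.card_fin, nsmul_eq_mul]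
    rcases hcost with h | h
    · refine ⟨_, lt_add_one _, 1, one_pos, fun {n L} hn hL c _ => ?_⟩
      have hL' : (0 : ℝ) < L := by exact_mod_cast hL
      rw [one_div, inv_mul_le_iff₀ hL']
      refine (Finset.sum_le_sum fun l _ => havg hn (c l) b fun i => h _).trans (le_of_eq ?_)
      rw [Finset.sum_const, Finset.card_univ, Fintype.card_fin, nsmul_eq_mul]
    · obtain ⟨a, ha, hab⟩ := exists_between h
      have ha0 : 0 ≤ a := hE0.trans ha.le
      refine ⟨a, ha, (b - a) / (G + 1), div_pos (by linarith) (by linarith),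
        fun {n L} hn hL c hc => ?_⟩
      have hn' : (0 : ℝ) < n := by exact_mod_cast hn
      have hL' : (0 : ℝ) < L := by exact_mod_cast hL
      have h1 : ∀ l, (1 / (n : ℝ)) * ∑ i, γ (c l i) ≤
          a + G * (if ∑ i, γ (c l i) ≤ n * a then 0 else 1) := by
        intro l
        split_ifs with hl
        · rw [mul_zero, add_zero, one_div, inv_mul_le_iff₀ hn']
          exact hl
        · have := havg hn (c l) G fun i => hG _
          linarith
      have h2 : (1 / (L : ℝ)) * ∑ l, (1 / (n : ℝ)) * ∑ i, γ (c l i) ≤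
          a + G * ((1 / (L : ℝ)) * ∑ l, (if ∑ i, γ (c l i) ≤ n * a then 0 else 1)) := by
        refine (mul_le_mul_of_nonneg_left (Finset.sum_le_sum fun l _ => h1 l)
          (by positivity)).trans (le_of_eq ?_)
        rw [Finset.sum_add_distrib, Finset.sum_const, Finset.card_univ, Fintype.card_fin,
          nsmul_eq_mul, ← Finset.mul_sum]
        field_simp
      have h3 : G * ((b - a) / (G + 1)) ≤ b - a := by
        rw [mul_div_assoc', div_le_iff₀ (by linarith)]
        nlinarith
      have h4 := mul_le_mul_of_nonneg_left hc hG0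
      linarith
  refine ⟨hR0, fun ε hε => ?_⟩
  have hlog2 : 0 < Real.log 2 := Real.log_pos one_lt_two
  have hlog2' : Real.log 2 ≤ 1 := by linarith [Real.log_two_lt_d9]
  -- The factor ln 2 converts divergence in nats to leakage in bits.
  set ε' := min (ε * Real.log 2) η with hε'
  have hε'0 : 0 < ε' := lt_min (mul_pos hε hlog2) hη
  have hA : ∀ v y, 0 ≤ push (chanY W) (K v) y := fun v => push_nonneg (K v).2.1 (chanY_nonneg W)
  have hB : ∀ v z, 0 ≤ push (chanZ W) (K v) z := fun v => push_nonneg (K v).2.1 (chanZ_nonneg W)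
  have hA1 : ∀ v, ∑ y, push (chanY W) (K v) y = 1 := fun v => by
    rw [sum_push (sum_chanY W)]
    exact (K v).2.2
  have hB1 : ∀ v, ∑ z, push (chanZ W) (K v) z = 1 := fun v => by
    rw [sum_push (sum_chanZ W)]
    exact (K v).2.2
  rw [← testInfo_sub W hκ K] at hR
  filter_upwards [eventually_exists_block_code hlam hlam1 hκ hκ1 hA hA1 hB hB1 γ ha hR0 hR hε'0,
    eventually_gt_atTop 0] with n ⟨L, u, c, dec, hL, hc, h⟩ hn
  have hbudget : ∀ m, (1 / (L : ℝ)) * ∑ l, (1 / (n : ℝ)) * ∑ i, ∑ a, K (c m l i) a * C a ≤ b :=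
    fun m => hcode hn hL (c m) ((h m).2.2.trans (min_le_right _ _))
  refine ⟨codeOfCodebook hL K c dec hbudget, max_le ?_ ?_⟩
  · have : Nonempty (Msg n R) := Fintype.card_pos_iff.1 (card_msg_pos n hR0)
    refine ciSup_le fun m => ?_
    rw [errorProb_eq]
    simp only [mainOut_codeOfCodebook]
    refine (h m).1.trans ((min_le_left _ _).trans ?_)
    exact mul_le_of_le_one_right hε.le hlog2'
  · have : Nonempty (stdSimplex ℝ (Msg n R)) :=
      ⟨⟨uniformMsg n R, uniformMsg_nonneg, sum_uniformMsg n hR0⟩⟩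
    refine ciSup_le fun pM => ?_
    have hQ0 := push_nonneg (powKer_nonneg hκ u) (powKer_nonneg (n := n) hB)
    rw [leakage_eq]
    -- The reference law is the same for every message, so the bound holds for every prior.
    refine (kernelInfo_le pM.2.1 pM.2.2 (eavesOut_nonneg _) (sum_eavesOut _) hQ0
      (le_of_eq (by rw [sum_push (sum_powKer hB1), sum_powKer hκ1])) fun m z hz => ?_).trans ?_
    · rw [eavesOut_codeOfCodebook] at hz
      exact push_pos_of_mixOut_pos (powKer_nonneg hκ u) (powKer_nonneg hB) (hc m) hz
    · rw [div_le_iff₀ hlog2]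
      calc _ ≤ ∑ m, pM m * (ε * Real.log 2) := Finset.sum_le_sum fun m _ => by
            refine mul_le_mul_of_nonneg_left ?_ (pM.2.1 m)
            simp only [eavesOut_codeOfCodebook]
            exact (h m).2.1.trans (min_le_left _ _)
        _ = ε * Real.log 2 := by
            rw [← Finset.sum_mul]
            exact (congrArg (· * (ε * Real.log 2)) pM.2.2).trans (one_mul _)

variable [Nonempty X]

/-- Random coding needs strict slack in the cost. If some input costs less than `b`, mixing in a
little of it provides the slack. If not, the optimal law already meets the constraint letter by
letter. -/
theorem mem_semRates_of_lt_singleLetter (hC : ∀ x, 0 ≤ C x) (hb : ∃ x, C x ≤ b) {R : ℝ}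
    (hR0 : 0 ≤ R) (hR : R < singleLetter W C b) : R ∈ semRates W C b := by
  obtain ⟨q, hq, hq1, hq2⟩ := exists_mem_region_singleLetter W C hb
  by_cases hmin : ∃ x, C x < b
  · obtain ⟨x, hx⟩ := hmin
    rw [← hq1] at hR
    -- Chosen so that (1 - s) q.1 is the midpoint of R and q.1, still above R.
    set s := (q.1 - R) / (2 * q.1)
    have hq0 : 0 < q.1 := hR0.trans_lt hR
    have hs0 : 0 < s := div_pos (by linarith) (by linarith)
    have hs1 : s < 1 := by
      rw [div_lt_one (by linarith)]
      linarith
    have hmem := convex_convexHull ℝ _ hq (zero_gain_mem_region W C x) (sub_nonneg.2 hs1.le) hs0.le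
      (sub_add_cancel 1 s)
    obtain ⟨k, l, lam, κ, K, -, h1, h2⟩ := exists_law_of_mem_region hmem
    refine mem_semRates_of_lt hC lam.2.1 lam.2.2 (fun u => (κ u).2.1) (fun u => (κ u).2.2) K
      (Or.inr ?_) hR0 ?_
    · refine lt_of_eq_of_lt h2.symm ?_
      simp only [Prod.snd_add, Prod.smul_snd, smul_eq_mul]
      have := mul_le_mul_of_nonneg_left hq2 (sub_nonneg.2 hs1.le)
      have := mul_lt_mul_of_pos_left hx hs0
      linarith
    · refine lt_of_lt_of_eq ?_ h1
      simp only [Prod.fst_add, Prod.smul_fst, smul_eq_mul, mul_zero, add_zero]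
      have : s * q.1 = (q.1 - R) / 2 := by
        simp only [s]
        field_simp
      linarith
  · push Not at hmin
    obtain ⟨k, l, lam, κ, K, hpos, h1, h2⟩ := exists_law_of_mem_region hq
    refine mem_semRates_of_lt hC lam.2.1 lam.2.2 (fun u => (κ u).2.1) (fun u => (κ u).2.2) K
      (Or.inl fun v => ?_) hR0 (by rw [← hq1, h1] at hR; exact hR)
    -- All inputs cost at least `b`, and each letter of V has positive probability, so one letter
    -- above `b` would push the mean above `b`.
    by_contra! hv
    have hK : ∀ v, b ≤ ∑ x, K v x * C x := fun v => by
      have h : ∑ x, K v x * b = b := by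
        rw [← Finset.sum_mul]
        exact (congrArg (· * b) (K v).2.2).trans (one_mul b)
      rw [← h]
      exact Finset.sum_le_sum fun x _ => mul_le_mul_of_nonneg_left (hmin x) ((K v).2.1 x)
    have hw : ∀ u v, 0 ≤ lam u * κ u v := fun u v => mul_nonneg (lam.2.1 u) ((κ u).2.1 v)
    have hw1 : ∑ u, ∑ v, lam u * κ u v = 1 := by
      simp only [← Finset.mul_sum]
      rw [Finset.sum_congr rfl fun u _ => by rw [show ∑ v, κ u v = 1 from (κ u).2.2, mul_one]]
      exact lam.2.2
    obtain ⟨u, hu⟩ := hpos v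
    have hlt : ∑ u, ∑ v, lam u * κ u v * b < ∑ u, ∑ v, lam u * κ u v * ∑ x, K v x * C x :=
      Finset.sum_lt_sum (fun u _ => Finset.sum_le_sum fun v _ =>
        mul_le_mul_of_nonneg_left (hK v) (hw u v)) ⟨u, Finset.mem_univ u,
        Finset.sum_lt_sum (fun v _ => mul_le_mul_of_nonneg_left (hK v) (hw u v))
          ⟨v, Finset.mem_univ v, mul_lt_mul_of_pos_left hv hu⟩⟩
    simp only [← Finset.sum_mul, hw1, one_mul] at hlt
    rw [← h2] at hlt
    exact hlt.not_ge hq2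

/-- At rate zero there is a single message, so nothing can be misdecoded or leaked. This case is
separate because no nonnegative rate lies below a single-letter value of 0, while the set of rates
must be nonempty. -/
theorem zero_mem_semRates (hb : ∃ x, C x ≤ b) : (0 : ℝ) ∈ semRates W C b := by
  classical
  obtain ⟨x, hx⟩ := hb
  refine ⟨le_rfl, fun ε hε => ?_⟩
  filter_upwards [eventually_gt_atTop 0] with n hn
  have hn' : (n : ℝ) ≠ 0 := by exact_mod_cast hn.ne'
  have hsub : Subsingleton (Msg n 0) := by
    rw [← Fintype.card_le_one_iff_subsingleton]
    simp
  have hne : Nonempty (Msg n 0) := Fintype.card_pos_iff.1 (card_msg_pos n le_rfl)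
  let m₀ : Msg n 0 := Classical.arbitrary _
  let c : Code X Y C b n 0 :=
    { enc := fun _ => ⟨Pi.single (fun _ => x) 1, single_mem_stdSimplex ℝ _⟩
      cost_le := fun m => by
        change ∑ y, (Pi.single (fun _ => x) (1 : ℝ) : (Fin n → X) → ℝ) y * blockCost C y ≤ b
        rw [Fintype.sum_eq_single (fun _ => x) fun y hy => by rw [Pi.single_eq_of_ne hy, zero_mul],
          Pi.single_eq_same, one_mul, blockCost, Finset.sum_const, Finset.card_univ,
          Fintype.card_fin, nsmul_eq_mul, ← mul_assoc, one_div_mul_cancel hn', one_mul]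
        exact hx
      dec := fun _ => m₀ }
  refine ⟨c, max_le (ciSup_le fun m => ?_) ?_⟩
  · rw [errorProb_eq]
    simp only [ne_eq, Subsingleton.elim _ m, not_true_eq_false, if_false, Finset.sum_const_zero]
    exact hε.le
  · have : Nonempty (stdSimplex ℝ (Msg n 0)) :=
      ⟨⟨uniformMsg n 0, uniformMsg_nonneg, sum_uniformMsg n le_rfl⟩⟩
    refine ciSup_le fun pM => ?_
    rw [leakage_eq]
    refine (kernelInfo_le pM.2.1 pM.2.2 (eavesOut_nonneg c) (sum_eavesOut c)
      (q := eavesOut W c m₀) (eavesOut_nonneg c m₀) (sum_eavesOut c m₀).le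
      fun m z hz => ?_).trans ?_
    · rwa [Subsingleton.elim m₀ m]
    · have hz : ∀ m z, eavesOut W c m z * Real.log (eavesOut W c m z / eavesOut W c m₀ z) = 0 := by
        intro m z
        rw [Subsingleton.elim m₀ m]
        by_cases h : eavesOut W c m z = 0
        · rw [h, zero_mul]
        · rw [div_self h, Real.log_one, mul_zero]
      simp only [hz, Finset.sum_const_zero, mul_zero, zero_div]
      exact hε.le

/-- The single-letter expression is the supremum of each set of rates between the semantically
secure and the weakly secure ones. -/
theorem isLUB_of_subset (hC : ∀ x, 0 ≤ C x) (hb : ∃ x, C x ≤ b) {S : Set ℝ}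
    (h1 : semRates W C b ⊆ S) (h2 : S ⊆ weakRates W C b) : IsLUB S (singleLetter W C b) := by
  refine ⟨fun R hR => weakRates_le hb (h2 hR), fun B hB => le_of_forall_lt_imp_le_of_dense
    fun r hr => ?_⟩
  rcases lt_or_ge r 0 with h | h
  · exact h.le.trans (hB (h1 (zero_mem_semRates hb)))
  · exact hB (h1 (mem_semRates_of_lt_singleLetter hC hb h hr))

end Achievability

end Wiretap

end

/-- The semantic-security, strong-secrecy and weak-secrecy capacities of a cost-constrained
discrete memoryless wiretap channel coincide with the single-letter expression. The last four
conjuncts say that its supremum is a maximum and that the three capacities are suprema of nonempty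
bounded sets of rates. -/
theorem theorem1 {X Y Z : Type*} [Fintype X] [Fintype Y] [Fintype Z]
    (W : X → stdSimplex ℝ (Y × Z)) (C : X → ℝ) (hC : ∀ x, 0 ≤ C x)
    (b : ℝ) (hb : ∃ x, C x ≤ b) :
    (Wiretap.semCapacity W C b = Wiretap.strongCapacity W C b ∧
      Wiretap.strongCapacity W C b = Wiretap.weakCapacity W C b ∧
      Wiretap.weakCapacity W C b = Wiretap.singleLetter W C b) ∧
    IsGreatest (Wiretap.secrecyGains W C b) (Wiretap.singleLetter W C b) ∧
    IsLUB (Wiretap.semRates W C b) (Wiretap.semCapacity W C b) ∧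
    IsLUB (Wiretap.strongRates W C b) (Wiretap.strongCapacity W C b) ∧
    IsLUB (Wiretap.weakRates W C b) (Wiretap.weakCapacity W C b) := by
  have hX : Nonempty X := hb.nonempty
  have hss := Wiretap.semRates_subset (W := W) (C := C) (b := b)
  have hsw := Wiretap.strongRates_subset (W := W) (C := C) (b := b)
  have hsem := Wiretap.isLUB_of_subset hC hb subset_rfl (hss.trans hsw)
  have hstr := Wiretap.isLUB_of_subset hC hb hss hsw
  have hweak := Wiretap.isLUB_of_subset hC hb (hss.trans hsw) subset_rfl
  have h0 := Wiretap.zero_mem_semRates (W := W) hb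
  have e1 : Wiretap.semCapacity W C b = Wiretap.singleLetter W C b := hsem.csSup_eq ⟨0, h0⟩
  have e2 : Wiretap.strongCapacity W C b = Wiretap.singleLetter W C b :=
    hstr.csSup_eq ⟨0, hss h0⟩
  have e3 : Wiretap.weakCapacity W C b = Wiretap.singleLetter W C b :=
    hweak.csSup_eq ⟨0, hsw (hss h0)⟩
  refine ⟨⟨e1.trans e2.symm, e2.trans e3.symm, e3⟩, Wiretap.isGreatest_singleLetter W C hb, ?_⟩
  rw [e1, e2, e3]
  exact ⟨hsem, hstr, hweak⟩
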